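/- Let $\Gamma\neq\{e\}$ be a finite subgroup of $SL(2,\mathbf{C})$, let $L=\mathbf{C}^2$ with standard basis $x,y$ and symplectic form $\omega_L$, $\omega_L(x,y)=1$, and let $N\geq 1$. Let $\mathbf{\Gamma}_N=S_N\ltimes\Gamma^N$ be the wreath product, acting naturally on $V=L^{\oplus N}$. For $u\in L$ and $\gamma\in\Gamma$ write $u_i\in V$ and $\gamma_i\in\Gamma^N$ for the copies of $u$ and $\gamma$ in the $i$th factor, and let $s_{ij}\in S_N$ be the transposition of $i$ and $j$. Let $k\in\mathbf{C}$ with $k\neq 0$, and let $c$ be a complex valued class function on $\Gamma\setminus\{e\}$. Let $H_{1,k,c}(\mathbf{\Gamma}_N)$ be the quotient of the smash product $\mathbf{\Gamma}_N\sharp TV$ of the tensor algebra $TV$ with $\mathbf{\Gamma}_N$ by the relations $$[x_i,y_i]=1+\frac{k}{2}\sum_{j\neq i}\sum_{\gamma\in\Gamma}s_{ij}\gamma_i\gamma_j^{-1}+\sum_{\gamma\in\Gamma\setminus\{e\}}c_\gamma\gamma_i\qquad(1\le i\le N),$$ $$[u_i,v_j]=-\frac{k}{2}\sum_{\gamma\in\Gamma}\omega_L(\gamma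 u,v)\,s_{ij}\gamma_i\gamma_j^{-1}\qquad(u,v\in L,\ i\neq j).$$ Let $W$ be an irreducible finite dimensional complex representation of $S_N$ and $Y_h$ an irreducible finite dimensional complex representation of $\Gamma$. Let $\mathbf{\Gamma}_N$ act on $W\otimes Y_h^{\otimes N}$ so that $\Gamma^N$ acts factorwise on $Y_h^{\otimes N}$ and trivially on $W$, and $S_N$ acts on $W$ and permutes the factors of $Y_h^{\otimes N}$. Then the representation $W\otimes Y_h^{\otimes N}$ of $\mathbf{\Gamma}_N$ extends to a representation of $H_{1,k,c}(\mathbf{\Gamma}_N)$ on the same vector space if and only if there are integers $a,b$ such that $W$ is the irreducible representation of $S_N$ corresponding to the rectangular Young diagram of height $a$ and width $b$ (where the diagram with a single row corresponds to the trivial representation) and $$\dim Y_h+(b-a)\,\frac{k}{2}\,|\Gamma|+\sum_{s=2}^{\nu}c_s\,|C_s|\,\chi_{Y_h}(C_s)=0 .$$ Here $C_1=\{e\},C_2,\dots,C_\nu$ are the conjugacy classes of $\Gamma$, $c_s$ is the value of $c$ on $C_s$, and $\chi_{Y_h}$ is the character of $Y_h$. -/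

import Mathlib

open scoped TensorProduct

noncomputable section

/-! ## Wreath products -/

/-- The action of the symmetric group on `G^N` by permutation of the factors:
`(σ · f) i = f (σ⁻¹ i)`. -/
abbrev permFactors (G : Type*) [Group G] (N : ℕ) :
    Equiv.Perm (Fin N) →* MulAut (Fin N → G) :=
  mulAutArrow

/-- The wreath product `S_N ⋉ G^N`. -/
abbrev Wreath (G : Type*) [Group G] (N : ℕ) : Type _ :=
  (Fin N → G) ⋊[permFactors G N] Equiv.Perm (Fin N)

namespace Wreath

variable {G : Type*} [Group G] {N : ℕ}

/-- The element `γ_i = (e, …, γ, …, e)`, with `γ` in the `i`-th factor. -/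
def factor (i : Fin N) (γ : G) : Wreath G N := SemidirectProduct.inl (Pi.mulSingle i γ)

/-- The transposition `s_{ij}`, as an element of the wreath product. -/
def transp (i j : Fin N) : Wreath G N := SemidirectProduct.inr (Equiv.swap i j)

end Wreath

/-! ## The algebra `H_{1,k,c}` -/

namespace SympRefl

/-- The `2`-dimensional symplectic space `L = ℂ²` with its standard symplectic basis. -/
abbrev L : Type := Fin 2 → ℂ

/-- The vector `x` of the symplectic basis of `L`. -/
def xL : L := ![1, 0]

/-- The vector `y` of the symplectic basis of `L`. -/
def yL : L := ![0, 1]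

/-- The symplectic form of `L`, with `ω(x, y) = 1`. -/
def omegaL (u v : L) : ℂ := u 0 * v 1 - u 1 * v 0

variable (Γ : Subgroup (Matrix.SpecialLinearGroup (Fin 2) ℂ)) (N : ℕ)

/-- The natural action of `S_N ⋉ Γ^N` on `V = L^{⊕ N}`: the factors of `Γ^N` act on the
corresponding summands and `S_N` permutes the summands. -/
def act (g : Wreath Γ N) (v : Fin N → L) : Fin N → L :=
  fun i => Matrix.mulVec ((g.left i : Matrix.SpecialLinearGroup (Fin 2) ℂ) : Matrix (Fin 2) (Fin 2) ℂ)
    (v (g.right⁻¹ i))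

/-- The free algebra on the elements of `S_N ⋉ Γ^N` and on the vectors of `V = L^{⊕ N}`. -/
abbrev Free : Type := FreeAlgebra ℂ (Wreath Γ N ⊕ (Fin N → L))

variable {Γ N}

/-- The generator attached to a group element. -/
def grp (g : Wreath Γ N) : Free Γ N := FreeAlgebra.ι ℂ (Sum.inl g)

/-- The generator attached to a vector of `V`. -/
def vec (v : Fin N → L) : Free Γ N := FreeAlgebra.ι ℂ (Sum.inr v)

/-- The generator attached to `u_i`, the copy of `u ∈ L` in the `i`-th summand of `V`. -/
def vecAt (i : Fin N) (u : L) : Free Γ N := vec (Pi.single i u)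

variable [Fintype Γ]

open scoped Classical in
/-- The element `1 + (k/2) ∑_{j ≠ i} ∑_γ s_{ij} γ_i γ_j⁻¹ + ∑_{γ ≠ e} c_γ γ_i`. The class function
`c` is given as a function on the set of conjugacy classes; its value at the class of `e` is not
used. -/
def diagRHS (k : ℂ) (c : ConjClasses Γ → ℂ) (i : Fin N) : Free Γ N :=
  1 + (k / 2) • ∑ j ∈ Finset.univ.filter (fun j : Fin N => j ≠ i), ∑ γ : Γ,
        grp (Wreath.transp i j * Wreath.factor i γ * Wreath.factor j γ⁻¹)
    + ∑ γ ∈ Finset.univ.filter (fun γ : Γ => γ ≠ 1), c (ConjClasses.mk γ) • grp (Wreath.factor i γ)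

/-- The element `-(k/2) ∑_γ ω(γ u, v) s_{ij} γ_i γ_j⁻¹`. -/
def offDiagRHS (k : ℂ) (i j : Fin N) (u v : L) : Free Γ N :=
  -((k / 2) • ∑ γ : Γ,
      omegaL (Matrix.mulVec
        ((γ : Matrix.SpecialLinearGroup (Fin 2) ℂ) : Matrix (Fin 2) (Fin 2) ℂ) u) v •
        grp (Wreath.transp i j * Wreath.factor i γ * Wreath.factor j γ⁻¹))

/-- The defining relations. The first five families present the smash product of the tensor
algebra of `V` with the group; the last two are the commutation relations of the symplectic
reflection algebra. -/
inductive Rel (k : ℂ) (c : ConjClasses Γ → ℂ) : Free Γ N → Free Γ N → Prop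
  | grp_one : Rel k c (grp 1) 1
  | grp_mul (g h : Wreath Γ N) : Rel k c (grp (g * h)) (grp g * grp h)
  | vec_add (v w : Fin N → L) : Rel k c (vec (v + w)) (vec v + vec w)
  | vec_smul (r : ℂ) (v : Fin N → L) : Rel k c (vec (r • v)) (r • vec v)
  | smash (g : Wreath Γ N) (v : Fin N → L) :
      Rel k c (grp g * vec v) (vec (act Γ N g v) * grp g)
  | diag (i : Fin N) :
      Rel k c (vecAt i xL * vecAt i yL - vecAt i yL * vecAt i xL) (diagRHS k c i)
  | offDiag (i j : Fin N) (hij : i ≠ j) (u v : L) :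
      Rel k c (vecAt i u * vecAt j v - vecAt j v * vecAt i u) (offDiagRHS k i j u v)

/-- The wreath product symplectic reflection algebra `H_{1,k,c}(S_N ⋉ Γ^N)`. -/
abbrev Alg (N : ℕ) (k : ℂ) (c : ConjClasses Γ → ℂ) : Type :=
  RingQuot (Rel (Γ := Γ) (N := N) k c)

/-- The image in `H_{1,k,c}(S_N ⋉ Γ^N)` of an element of the group. -/
def ofGroup (k : ℂ) (c : ConjClasses Γ → ℂ) (g : Wreath Γ N) : Alg N k c :=
  RingQuot.mkAlgHom ℂ (Rel (Γ := Γ) (N := N) k c) (grp g)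

/-- A representation of `S_N ⋉ Γ^N` extends to `H_{1,k,c}(S_N ⋉ Γ^N)`: the same vector space
carries a representation of the algebra in which the group elements act as given. -/
def Extends (k : ℂ) (c : ConjClasses Γ → ℂ) {M : Type*} [AddCommGroup M] [Module ℂ M]
    (ρ : Representation ℂ (Wreath Γ N) M) : Prop :=
  ∃ Φ : Alg N k c →ₐ[ℂ] Module.End ℂ M, ∀ g : Wreath Γ N, Φ (ofGroup k c g) = ρ g

end SympRefl

/-! ## Representations of trivial type -/

section TrivialType

variable {G : Type*} [Group G] {N : ℕ} {Y W : Type*} [AddCommGroup Y] [Module ℂ Y]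
  [AddCommGroup W] [Module ℂ W]

/-- The representation of `S_N ⋉ G^N` on `Y^{⊗ N}`: the factors of `G^N` act on the corresponding
tensor factors and `S_N` permutes the tensor factors. -/
def tensorPower (ρY : Representation ℂ G Y) (N : ℕ) :
    Representation ℂ (Wreath G N) (PiTensorProduct ℂ (fun _ : Fin N => Y)) where
  toFun g := PiTensorProduct.map (fun i => ρY (g.left i)) ∘ₗ
    (PiTensorProduct.reindex ℂ (fun _ : Fin N => Y) g.right).toLinearMap
  map_one' := by
    ext v
    simp [PiTensorProduct.reindex_tprod]
    rfl
  map_mul' g h := by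
    ext v
    simp only [LinearMap.compMultilinearMap_apply, LinearMap.comp_apply, Module.End.mul_apply,
      LinearEquiv.coe_coe, PiTensorProduct.reindex_tprod, PiTensorProduct.map_tprod]
    congr 1
    funext i
    simp [SemidirectProduct.mul_left, SemidirectProduct.mul_right, mulAutArrow]
    rfl

theorem tensorPower_tprod (ρY : Representation ℂ G Y) (N : ℕ) (g : Wreath G N) (v : Fin N → Y) :
    tensorPower ρY N g (PiTensorProduct.tprod ℂ v) =
      PiTensorProduct.tprod ℂ (fun i => ρY (g.left i) (v (g.right⁻¹ i))) := by
  simp only [tensorPower, MonoidHom.coe_mk, OneHom.coe_mk, LinearMap.comp_apply,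
    LinearEquiv.coe_coe, PiTensorProduct.reindex_tprod, PiTensorProduct.map_tprod]
  rfl

/-- The representation `W ⊗ Y^{⊗ N}` of `S_N ⋉ G^N`, where `G^N` acts trivially on `W`. -/
def trivialType (ρW : Representation ℂ (Equiv.Perm (Fin N)) W) (ρY : Representation ℂ G Y) :
    Representation ℂ (Wreath G N) (W ⊗[ℂ] PiTensorProduct ℂ (fun _ : Fin N => Y)) :=
  Representation.tprod
    (MonoidHom.comp ρW (SemidirectProduct.rightHom : Wreath G N →* Equiv.Perm (Fin N)))
    (tensorPower ρY N)

/-- The value of the character of a representation on a conjugacy class. -/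
def classCharacter (ρY : Representation ℂ G Y) : ConjClasses G → ℂ :=
  Quotient.lift (fun γ : G => ρY.character γ) (by
    intro a b hab
    obtain ⟨g, hg⟩ := isConj_iff.mp hab
    show ρY.character a = ρY.character b
    rw [← hg, Representation.char_mul_comm, inv_mul_cancel_left])

end TrivialType

/-! ## Irreducible representations of the symmetric group -/

namespace YoungRep

variable {N : ℕ} {μ : YoungDiagram}

open scoped Classical in
/-- The sum, in the group algebra, of the permutations preserving each row of the Young tableau
`T` (a bijective filling of the cells of `μ`, where `(i, j)` is the cell in row `i` and
column `j`). -/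
def rowSum (T : Fin N ≃ μ.cells) : MonoidAlgebra ℂ (Equiv.Perm (Fin N)) :=
  ∑ p ∈ Finset.univ.filter (fun p : Equiv.Perm (Fin N) => ∀ m, (T (p m)).1.1 = (T m).1.1),
    MonoidAlgebra.of ℂ _ p

open scoped Classical in
/-- The signed sum of the permutations preserving each column of `T`. -/
def colSum (T : Fin N ≃ μ.cells) : MonoidAlgebra ℂ (Equiv.Perm (Fin N)) :=
  ∑ q ∈ Finset.univ.filter (fun q : Equiv.Perm (Fin N) => ∀ m, (T (q m)).1.2 = (T m).1.2),
    ((Equiv.Perm.sign q : ℤ) : ℂ) • MonoidAlgebra.of ℂ _ q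

/-- The Young symmetrizer of `T`. -/
def youngSymmetrizer (T : Fin N ≃ μ.cells) : MonoidAlgebra ℂ (Equiv.Perm (Fin N)) :=
  rowSum T * colSum T

/-- A representation of `S_N` corresponds to the Young diagram `μ` if it is isomorphic to the
left ideal `ℂ[S_N] c_T` of the group algebra generated by the Young symmetrizer of a tableau `T`
of shape `μ`. The one-row diagram corresponds to the trivial representation. -/
def CorrespondsTo {W : Type*} [AddCommGroup W] [Module ℂ W]
    (ρW : Representation ℂ (Equiv.Perm (Fin N)) W) (μ : YoungDiagram) : Prop :=
  ∃ T : Fin N ≃ μ.cells, Nonempty (ρW.asModule ≃ₗ[MonoidAlgebra ℂ (Equiv.Perm (Fin N))]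
    (Ideal.span {youngSymmetrizer T} : Ideal (MonoidAlgebra ℂ (Equiv.Perm (Fin N)))))

/-- The rectangular Young diagram of height `a` and width `b`. -/
def rect (a b : ℕ) : YoungDiagram where
  cells := Finset.range a ×ˢ Finset.range b
  isLowerSet := by
    rintro ⟨i, j⟩ ⟨i', j'⟩ h hm
    simp only [Finset.coe_product, Finset.coe_range, Set.mem_prod, Set.mem_Iio] at hm ⊢
    exact ⟨lt_of_le_of_lt h.1 hm.1, lt_of_le_of_lt h.2 hm.2⟩

end YoungRep

open scoped Classical in
/-- The sum `∑ c_s |C_s| χ_Y(C_s)` over the conjugacy classes `C_s ≠ {e}`. -/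
def classSum {G : Type*} [Group G] [Fintype G] {Y : Type*} [AddCommGroup Y] [Module ℂ Y]
    (c : ConjClasses G → ℂ) (ρY : Representation ℂ G Y) : ℂ :=
  ∑ C ∈ Finset.univ.filter (fun C : ConjClasses G => C ≠ ConjClasses.mk 1),
    c C * (Nat.card C.carrier : ℂ) * classCharacter ρY C

end

/-! A nontrivial finite subgroup $\Gamma$ of $SL(2,\mathbf{C})$ has a central element $z\neq e$. By
Schur's lemma $z$ acts on $Y$ by a scalar, whereas $z-1$ is invertible on $L$. Conjugating $u_i$ by
$z_i$ then forces every vector of $V$ to act by zero (`vec_eq_zero`). So the representation extends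
if and only if the right hand sides of the commutation relations act by zero.

The off-diagonal ones always do: replacing $\gamma$ by $\gamma z$ does not change the operator of
$s_{ij}\gamma_i\gamma_j^{-1}$, so the sum for $u$ equals the sum for $zu$
(`sum_omegaL_smul_eq_zero`). For the diagonal ones, orthogonality of matrix coefficients shows that
$\sum_\gamma s_{ij}\gamma_i\gamma_j^{-1}$ acts as $\frac{|\Gamma|}{\dim Y}\,s_{ij}\otimes 1$, and
the class sum acts by a scalar (`evalZero_diagRHS`). What remains is that $\sum_{j\ne i}s_{ij}$ acts
on $W$ by one prescribed scalar, the same for all $i$.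

Such $W$ are the rectangular ones, the scalar being width minus height (`starAct_eq_smul_iff`).
Every irreducible $W$ is generated by a Young symmetrizer (`exists_correspondsTo`). A Garnir
relation computes the eigenvalue on the symmetrizer for $i$ in the last row, and on its transposed
analogue for $i$ in the last column; the two agree only if the last row is as long as the first. -/

noncomputable section

/-! ### Signed sums over fiber-preserving permutations -/

namespace YoungRep

open Equiv (Perm swap)

variable {N : ℕ}

/-- The group algebra of the symmetric group. -/
abbrev SymAlg (N : ℕ) : Type := MonoidAlgebra ℂ (Perm (Fin N))

/-- The element of the group algebra attached to a permutation. -/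
abbrev perm (p : Perm (Fin N)) : SymAlg N := MonoidAlgebra.of ℂ _ p

open scoped Classical in
/-- The sum of the permutations preserving the fibers of `f`, weighted by a sign character. -/
def fiberSum (χ : Perm (Fin N) →* ℤˣ) (f : Fin N → ℕ) : SymAlg N :=
  ∑ p ∈ Finset.univ.filter (fun p : Perm (Fin N) => ∀ m, f (p m) = f m),
    ((χ p : ℤ) : ℂ) • perm p

variable {μ : YoungDiagram}

/-- The row index of an entry of a tableau. -/
def rowOf (T : Fin N ≃ μ.cells) (m : Fin N) : ℕ := (T m).1.1

/-- The column index of an entry of a tableau. -/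
def colOf (T : Fin N ≃ μ.cells) (m : Fin N) : ℕ := (T m).1.2

theorem rowSum_eq_fiberSum (T : Fin N ≃ μ.cells) : rowSum T = fiberSum 1 (rowOf T) := by
  simp only [rowSum, fiberSum, rowOf, MonoidHom.one_apply, Units.val_one, Int.cast_one, one_smul]
  congr!

theorem colSum_eq_fiberSum (T : Fin N ≃ μ.cells) :
    colSum T = fiberSum Perm.sign (colOf T) := rfl

theorem sign_mul_self (χ : Perm (Fin N) →* ℤˣ) (p : Perm (Fin N)) :
    ((χ p : ℤ) : ℂ) * ((χ p : ℤ) : ℂ) = 1 := by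
  rw [← Int.cast_mul, ← Units.val_mul, Int.units_mul_self]; simp

theorem perm_mul (p q : Perm (Fin N)) : perm p * perm q = perm (p * q) :=
  (map_mul (MonoidAlgebra.of ℂ _) p q).symm

theorem perm_mul_fiberSum (χ : Perm (Fin N) →* ℤˣ) (f : Fin N → ℕ) {p : Perm (Fin N)}
    (hp : ∀ m, f (p m) = f m) :
    perm p * fiberSum χ f = ((χ p : ℤ) : ℂ) • fiberSum χ f := by
  classical
  unfold fiberSum
  rw [Finset.mul_sum, Finset.smul_sum]
  refine Finset.sum_bij' (fun q _ => p * q) (fun q _ => p⁻¹ * q) ?_ ?_ ?_ ?_ ?_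
  · intro q hq
    simp only [Finset.mem_filter, Finset.mem_univ, true_and] at hq ⊢
    intro m; simp [hp, hq]
  · intro q hq
    simp only [Finset.mem_filter, Finset.mem_univ, true_and] at hq ⊢
    intro m; rw [← hp]; simp [hq]
  · intro q _; simp
  · intro q _; simp
  · intro q _
    rw [smul_smul, map_mul, Units.val_mul, Int.cast_mul, ← mul_assoc, sign_mul_self, one_mul,
      mul_smul_comm, perm_mul]

theorem fiberSum_mul_perm (χ : Perm (Fin N) →* ℤˣ) (f : Fin N → ℕ) {p : Perm (Fin N)}
    (hp : ∀ m, f (p m) = f m) :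
    fiberSum χ f * perm p = ((χ p : ℤ) : ℂ) • fiberSum χ f := by
  classical
  unfold fiberSum
  rw [Finset.sum_mul, Finset.smul_sum]
  refine Finset.sum_bij' (fun q _ => q * p) (fun q _ => q * p⁻¹) ?_ ?_ ?_ ?_ ?_
  · intro q hq
    simp only [Finset.mem_filter, Finset.mem_univ, true_and] at hq ⊢
    intro m; simp [hp, hq]
  · intro q hq
    simp only [Finset.mem_filter, Finset.mem_univ, true_and] at hq ⊢
    intro m; rw [Perm.mul_apply, hq, ← hp]; simp
  · intro q _; simp
  · intro q _; simp
  · intro q _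
    rw [smul_smul, map_mul, Units.val_mul, Int.cast_mul, mul_comm, mul_assoc, sign_mul_self,
      mul_one, smul_mul_assoc, perm_mul]

theorem perm_mul_fiberSum_mul_perm_inv (χ : Perm (Fin N) →* ℤˣ) (f : Fin N → ℕ)
    (g : Perm (Fin N)) :
    perm g * fiberSum χ f = fiberSum χ (fun m => f (g⁻¹ m)) * perm g := by
  classical
  unfold fiberSum
  rw [Finset.mul_sum, Finset.sum_mul]
  refine Finset.sum_bij' (fun q _ => g * q * g⁻¹) (fun q _ => g⁻¹ * q * g) ?_ ?_ ?_ ?_ ?_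
  · intro q hq
    simp only [Finset.mem_filter, Finset.mem_univ, true_and] at hq ⊢
    intro m; simp [hq]
  · intro q hq
    simp only [Finset.mem_filter, Finset.mem_univ, true_and] at hq ⊢
    intro m; simpa using hq (g m)
  · intro q _; group
  · intro q _; group
  · intro q _
    rw [mul_smul_comm, smul_mul_assoc, perm_mul, perm_mul]
    congr 2
    · rw [map_mul, map_mul, map_inv, mul_comm (χ g), mul_inv_cancel_right]
    · group

/-- The coefficient of the identity. -/
def coeffOne : SymAlg N →ₗ[ℂ] ℂ :=
  Finsupp.lapply 1 ∘ₗ (MonoidAlgebra.coeffLinearEquiv ℂ).toLinearMap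

theorem coeffOne_perm (p : Perm (Fin N)) : coeffOne (perm p) = if p = 1 then 1 else 0 := by
  simp [coeffOne, MonoidAlgebra.coeffLinearEquiv, Finsupp.single_apply]

/-- A permutation preserving the fibers of two functions which jointly separate points is `1`. -/
theorem eq_one_of_preserves {f g : Fin N → ℕ} (hfg : ∀ x y, f x = f y → g x = g y → x = y)
    {p : Perm (Fin N)} (hf : ∀ m, f (p m) = f m) (hg : ∀ m, g (p m) = g m) : p = 1 :=
  Equiv.ext fun m => hfg _ _ (hf m) (hg m)

/-- If $pq=1$ with $p$ preserving `f` and $q$ preserving `g`, then $p=q^{-1}$ preserves both and is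
trivial; only the pair $(1,1)$ contributes. -/
theorem coeffOne_fiberSum_mul {f g : Fin N → ℕ} (hfg : ∀ x y, f x = f y → g x = g y → x = y)
    (χ ψ : Perm (Fin N) →* ℤˣ) : coeffOne (fiberSum χ f * fiberSum ψ g) = 1 := by
  classical
  have h1 : ∀ p q : Perm (Fin N), (∀ m, f (p m) = f m) → (∀ m, g (q m) = g m) → p * q = 1 →
      p = 1 ∧ q = 1 := by
    intro p q hp hq hpq
    obtain rfl : p = q⁻¹ := eq_inv_of_mul_eq_one_left hpq
    have : q = 1 := by
      refine eq_one_of_preserves hfg (fun m => ?_) hq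
      simpa using (hp (q m)).symm
    simp [this]
  unfold fiberSum
  rw [Finset.sum_mul_sum, map_sum]
  simp only [map_sum, smul_mul_smul_comm, perm_mul, map_smul, coeffOne_perm, smul_eq_mul]
  rw [Finset.sum_eq_single 1, Finset.sum_eq_single 1]
  · simp
  · intro q hq hq1
    simp [hq1]
  · simp
  · intro p hp hp1
    refine Finset.sum_eq_zero fun q hq => ?_
    rw [if_neg, mul_zero]
    exact fun h => hp1 (h1 p q (by simpa using hp) (by simpa using hq) h).1
  · simp

end YoungRep

/-! ### The Garnir relation and the sum of the transpositions moving a point -/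

namespace YoungRep

open Equiv (Perm swap)

variable {N : ℕ}

theorem swap_mul_swap_eq {i j y : Fin N} (hij : i ≠ j) (hiy : i ≠ y) (hjy : j ≠ y) :
    swap i j * swap i y = swap i y * swap y j := by
  ext x
  simp only [Perm.mul_apply, Equiv.swap_apply_def]
  split_ifs <;> simp_all

theorem preserves_swap {f : Fin N → ℕ} {x y : Fin N} (h : f x = f y) (m : Fin N) :
    f (swap x y m) = f m := by
  rw [Equiv.swap_apply_def]
  split_ifs <;> simp_all

/-- A Garnir relation: moving an entry into a fiber of `f` over which all its positions occur. -/
theorem sum_swap_mul_fiberSum_mul {f g : Fin N → ℕ}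
    (hfg : ∀ x y, f x = f y → g x = g y → x = y) {χ ψ : Perm (Fin N) →* ℤˣ} {ε : ℤˣ}
    (hχ : ∀ x y, x ≠ y → χ (swap x y) = ε) (hψ : ∀ x y, x ≠ y → ψ (swap x y) = -ε)
    {i : Fin N} {r : ℕ} (hir : f i ≠ r) (hr : ∀ x, f x = f i → ∃ y, f y = r ∧ g y = g x) :
    ∑ j ∈ Finset.univ.filter (fun j => f j = r),
      perm (swap i j) * (fiberSum χ f * fiberSum ψ g) =
        -((ε : ℤ) : ℂ) • (fiberSum χ f * fiberSum ψ g) := by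
  classical
  have hr' : ∀ x, ∃ y, f x = f i → f y = r ∧ g y = g x := fun x => by
    by_cases hx : f x = f i
    · obtain ⟨y, hy⟩ := hr x hx; exact ⟨y, fun _ => hy⟩
    · exact ⟨x, fun h => absurd h hx⟩
  choose η hη using hr'
  have hεε : ((ε : ℤ) : ℂ) * ((ε : ℤ) : ℂ) = 1 := by
    rw [← Int.cast_mul, ← Units.val_mul, Int.units_mul_self]; simp
  -- `Y p` is the only entry $j$ of the fiber over `r` for which $p^{-1}j$ and $p^{-1}i$ have the
  -- same `g`-value (`hYu`).
  set Y : Perm (Fin N) → Fin N := fun p => p (η (p⁻¹ i)) with hY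
  set R : Finset (Perm (Fin N)) :=
    Finset.univ.filter (fun p : Perm (Fin N) => ∀ m, f (p m) = f m) with hR
  set D : Finset (Fin N) := Finset.univ.filter (fun j => f j = r) with hD
  have hinv : ∀ p ∈ R, ∀ m, f (p⁻¹ m) = f m := fun p hp m => by
    simp only [hR, Finset.mem_filter, Finset.mem_univ, true_and] at hp
    simpa using (hp (p⁻¹ m)).symm
  have hfR : ∀ p ∈ R, ∀ m, f (p m) = f m := fun p hp m => by
    simp only [hR, Finset.mem_filter, Finset.mem_univ, true_and] at hp
    exact hp m
  have hYf : ∀ p ∈ R, f (Y p) = r := fun p hp => by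
    rw [hY]; simp only; rw [hfR p hp, (hη _ (hinv p hp i)).1]
  have hYD : ∀ p ∈ R, Y p ∈ D := fun p hp => by simp [hD, hYf p hp]
  have hYg : ∀ p ∈ R, g (p⁻¹ (Y p)) = g (p⁻¹ i) := fun p hp => by
    simpa [hY] using (hη _ (hinv p hp i)).2
  have hYu : ∀ p ∈ R, ∀ j, f j = r → g (p⁻¹ j) = g (p⁻¹ i) → j = Y p := fun p hp j hj hgj => by
    apply p⁻¹.injective
    apply hfg
    · rw [hinv p hp, hinv p hp, hj, hYf p hp]
    · rw [hgj, hYg p hp]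
  set B := fiberSum ψ g with hB
  -- Moved to the right of $p$, the transposition $(i\;Y_p)$ becomes one that preserves `g`, and `B`
  -- absorbs it with sign $-\varepsilon$.
  have key : ∀ p ∈ R, ∀ s, perm (s * swap i (Y p) * p) * B =
      -((ε : ℤ) : ℂ) • (perm (s * p) * B) := by
    intro p hp s
    have hne : p⁻¹ i ≠ p⁻¹ (Y p) := fun h => hir (by
      rw [p⁻¹.injective h]; exact hYf p hp)
    have h1 : s * swap i (Y p) * p = (s * p) * swap (p⁻¹ i) (p⁻¹ (Y p)) := by
      rw [mul_assoc, mul_assoc]; congr 1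
      rw [Equiv.mul_swap_eq_swap_mul]; simp
    rw [h1, ← perm_mul, mul_assoc, hB,
      perm_mul_fiberSum ψ g (preserves_swap (hYg p hp).symm), hψ _ _ hne, mul_smul_comm]
    simp
  have hsum : ∑ j ∈ D, perm (swap i j) * (fiberSum χ f * B) =
      ∑ p ∈ R, ∑ j ∈ D, ((χ p : ℤ) : ℂ) • (perm (swap i j * p) * B) := by
    rw [Finset.sum_comm]
    refine Finset.sum_congr rfl fun j _ => ?_
    rw [← mul_assoc, fiberSum, Finset.mul_sum, Finset.sum_mul]
    refine Finset.sum_congr rfl fun p _ => ?_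
    rw [mul_smul_comm, perm_mul, smul_mul_assoc]
  -- The terms with $j\ne Y_p$ cancel in pairs under $(p,j)\mapsto((Y_p\;j)\,p,\;Y_p)$: `χ` changes
  -- by $\varepsilon$ and `key` contributes $-\varepsilon$. The terms with $j=Y_p$ give the right
  -- hand side.
  have hrest : ∑ x ∈ (R ×ˢ D).filter (fun x => x.2 ≠ Y x.1),
      ((χ x.1 : ℤ) : ℂ) • (perm (swap i x.2 * x.1) * B) = 0 := by
    have hmem : ∀ x : Perm (Fin N) × Fin N, x ∈ (R ×ˢ D).filter (fun x => x.2 ≠ Y x.1) →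
        swap (Y x.1) x.2 * x.1 ∈ R ∧ Y (swap (Y x.1) x.2 * x.1) = x.2 := by
      rintro ⟨p, j⟩ hx
      simp only [Finset.mem_filter, Finset.mem_product] at hx
      obtain ⟨⟨hp, hj⟩, hjY⟩ := hx
      have hj' : f j = r := by simpa [hD] using hj
      have hR' : swap (Y p) j * p ∈ R := by
        simp only [hR, Finset.mem_filter, Finset.mem_univ, true_and, Perm.mul_apply]
        intro m
        rw [preserves_swap (f := f) (x := Y p) (y := j) (by rw [hYf p hp, hj']), hfR p hp]
      refine ⟨hR', (hYu _ hR' j hj' ?_).symm⟩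
      have hi1 : i ≠ Y p := fun h => hir (by rw [h]; exact hYf p hp)
      have hi2 : i ≠ j := fun h => hir (by rw [h]; exact hj')
      simp only [mul_inv_rev, Equiv.swap_inv, Perm.mul_apply, Equiv.swap_apply_right,
        Equiv.swap_apply_of_ne_of_ne hi1 hi2]
      exact hYg p hp
    refine Finset.sum_involution (fun x _ => (swap (Y x.1) x.2 * x.1, Y x.1)) ?_ ?_ ?_ ?_
    · rintro ⟨p, j⟩ hx
      have hx' := hx
      simp only [Finset.mem_filter, Finset.mem_product] at hx
      obtain ⟨⟨hp, hj⟩, hjY⟩ := hx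
      have hj' : f j = r := by simpa [hD] using hj
      have hi1 : i ≠ Y p := fun h => hir (by rw [h]; exact hYf p hp)
      have hi2 : i ≠ j := fun h => hir (by rw [h]; exact hj')
      have hk := key p hp (swap i j)
      rw [swap_mul_swap_eq hi2 hi1 hjY, mul_assoc] at hk
      simp only
      rw [hk, map_mul, hχ _ _ (Ne.symm hjY), smul_smul, Units.val_mul, Int.cast_mul, ← add_smul]
      rw [show ((χ p : ℤ) : ℂ) + ((ε : ℤ) : ℂ) * ((χ p : ℤ) : ℂ) * -((ε : ℤ) : ℂ) =
        ((χ p : ℤ) : ℂ) * (1 - ((ε : ℤ) : ℂ) * ((ε : ℤ) : ℂ)) by ring, hεε, sub_self, mul_zero,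
        zero_smul]
    · rintro ⟨p, j⟩ hx _ h
      simp only [Finset.mem_filter] at hx
      exact hx.2 (congrArg Prod.snd h).symm
    · rintro ⟨p, j⟩ hx
      have := hmem _ hx
      simp only [Finset.mem_filter, Finset.mem_product] at hx ⊢
      refine ⟨⟨this.1, hYD p hx.1.1⟩, ?_⟩
      rw [this.2]; exact Ne.symm hx.2
    · rintro ⟨p, j⟩ hx
      have := hmem _ hx
      simp only at this ⊢
      rw [this.2, ← mul_assoc, Equiv.swap_comm j, Equiv.swap_mul_self, one_mul]
  rw [hsum, ← Finset.sum_product' R D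
    (fun p j => ((χ p : ℤ) : ℂ) • (perm (swap i j * p) * B)),
    ← Finset.sum_filter_add_sum_filter_not (R ×ˢ D) (fun x => x.2 ≠ Y x.1), hrest, zero_add]
  have hdiag : (R ×ˢ D).filter (fun x => ¬ x.2 ≠ Y x.1) = R.image (fun p => (p, Y p)) := by
    ext ⟨p, j⟩
    simp only [Finset.mem_filter, Finset.mem_product, not_not, Finset.mem_image, Prod.mk.injEq]
    constructor
    · rintro ⟨⟨hp, _⟩, h⟩; exact ⟨p, hp, rfl, h.symm⟩
    · rintro ⟨q, hq, rfl, rfl⟩; exact ⟨⟨hq, hYD q hq⟩, rfl⟩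
  rw [hdiag, Finset.sum_image (by intro p _ q _ h; exact congrArg Prod.fst h)]
  rw [fiberSum, Finset.sum_mul, Finset.smul_sum]
  refine Finset.sum_congr rfl fun p hp => ?_
  have := key p hp 1
  rw [one_mul, one_mul] at this
  simp only
  rw [this, smul_mul_assoc, smul_comm]

/-- The sum of the transpositions moving `i`. -/
def star (i : Fin N) : SymAlg N :=
  ∑ j ∈ Finset.univ.filter (fun j => j ≠ i), perm (swap i j)

/-- Each other entry of the fiber of `i` contributes $\varepsilon$, and each other fiber contributes
$-\varepsilon$ as a whole by the Garnir relation; the two corrections by one cancel. When `f` is the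
row index of a tableau, `hr` holds for `i` in the last row. -/
theorem star_mul_fiberSum_mul {f g : Fin N → ℕ}
    (hfg : ∀ x y, f x = f y → g x = g y → x = y) {χ ψ : Perm (Fin N) →* ℤˣ} {ε : ℤˣ}
    (hχ : ∀ x y, x ≠ y → χ (swap x y) = ε) (hψ : ∀ x y, x ≠ y → ψ (swap x y) = -ε)
    {i : Fin N}
    (hr : ∀ x, f x = f i → ∀ z, ∃ y, f y = f z ∧ g y = g x) :
    star i * (fiberSum χ f * fiberSum ψ g) =
      (((ε : ℤ) : ℂ) * (((Finset.univ.filter (fun j => f j = f i)).card : ℂ) -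
        ((Finset.univ.image f).card : ℂ))) • (fiberSum χ f * fiberSum ψ g) := by
  classical
  set P := fiberSum χ f * fiberSum ψ g with hP
  have hdis : Finset.univ.filter (fun j => j ≠ i) =
      (Finset.univ.filter (fun j => f j = f i)).erase i ∪
        ((Finset.univ.image f).erase (f i)).biUnion
          (fun r => Finset.univ.filter (fun j => f j = r)) := by
    ext j
    simp only [Finset.mem_filter, Finset.mem_univ, true_and, Finset.mem_union, Finset.mem_erase,
      Finset.mem_biUnion, Finset.mem_image]
    constructor
    · intro h
      by_cases hj : f j = f i
      · exact Or.inl ⟨h, hj⟩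
      · exact Or.inr ⟨f j, ⟨hj, j, rfl⟩, rfl⟩
    · rintro (h | ⟨r, ⟨h1, -⟩, h2⟩)
      · exact h.1
      · rintro rfl; exact h1 h2.symm
  have hself : ∀ j ∈ (Finset.univ.filter (fun j => f j = f i)).erase i,
      perm (swap i j) * P = ((ε : ℤ) : ℂ) • P := by
    intro j hj
    simp only [Finset.mem_erase, Finset.mem_filter, Finset.mem_univ, true_and] at hj
    rw [hP, ← mul_assoc, perm_mul_fiberSum χ f (preserves_swap hj.2.symm), hχ _ _ (Ne.symm hj.1),
      smul_mul_assoc]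
  have hother : ∀ r ∈ (Finset.univ.image f).erase (f i),
      ∑ j ∈ Finset.univ.filter (fun j => f j = r), perm (swap i j) * P =
        -((ε : ℤ) : ℂ) • P := by
    intro r hrm
    simp only [Finset.mem_erase, Finset.mem_image, Finset.mem_univ, true_and] at hrm
    obtain ⟨h1, z, rfl⟩ := hrm
    exact sum_swap_mul_fiberSum_mul hfg hχ hψ (Ne.symm h1) fun x hx => hr x hx z
  rw [star, Finset.sum_mul, hdis, Finset.sum_union, Finset.sum_biUnion,
    Finset.sum_congr rfl hself, Finset.sum_congr rfl hother, Finset.sum_const, Finset.sum_const,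
    Finset.card_erase_of_mem (by simp), Finset.card_erase_of_mem (by simp)]
  · rw [← Nat.cast_smul_eq_nsmul ℂ, ← Nat.cast_smul_eq_nsmul ℂ, smul_smul, smul_smul, ← add_smul,
      Nat.cast_sub, Nat.cast_sub]
    · congr 1; push_cast; ring
    · exact Finset.card_pos.mpr ⟨f i, by simp⟩
    · exact Finset.card_pos.mpr ⟨i, by simp⟩
  · intro a _ b _ hab
    rw [Function.onFun, Finset.disjoint_left]
    intro j hj hj'
    simp only [Finset.mem_filter] at hj hj'
    exact hab (hj.2.symm.trans hj'.2)
  · rw [Finset.disjoint_left]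
    intro j hj hj'
    simp only [Finset.mem_erase, Finset.mem_filter, Finset.mem_biUnion] at hj hj'
    obtain ⟨r, ⟨h1, -⟩, -, h2⟩ := hj'
    exact h1 (h2.symm.trans hj.2.2)

theorem perm_mul_star (p : Perm (Fin N)) (i : Fin N) :
    perm p * star i = star (p i) * perm p := by
  unfold star
  rw [Finset.mul_sum, Finset.sum_mul]
  refine Finset.sum_bij' (fun j _ => p j) (fun j _ => p⁻¹ j) ?_ ?_ ?_ ?_ ?_
  · intro j; simp
  · intro j; simp [Equiv.Perm.inv_def, Equiv.symm_apply_eq]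
  · intro j _; simp
  · intro j _; simp
  · intro j _; rw [perm_mul, perm_mul, Equiv.mul_swap_eq_swap_mul]

end YoungRep

/-! ### Combinatorics of tableaux and products of row and column sums -/

namespace YoungRep

open Equiv (Perm swap)

variable {N : ℕ} {lam μ : YoungDiagram}

theorem row_col_separate (T : Fin N ≃ μ.cells) (x y : Fin N) (hr : rowOf T x = rowOf T y)
    (hc : colOf T x = colOf T y) : x = y :=
  T.injective (Subtype.ext (Prod.ext hr hc))

theorem mem_of_tableau (T : Fin N ≃ μ.cells) (x : Fin N) : (rowOf T x, colOf T x) ∈ μ :=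
  (T x).2

theorem exists_of_mem (T : Fin N ≃ μ.cells) {r s : ℕ} (h : (r, s) ∈ μ) :
    ∃ x, rowOf T x = r ∧ colOf T x = s :=
  ⟨T.symm ⟨(r, s), h⟩, by simp [rowOf], by simp [colOf]⟩

/-- If no two entries share a row of `T` and a column of `T'`, then the columns of `T'` can be
sorted so that no entry lies lower than it does in `T`. -/
theorem exists_column_sort (T : Fin N ≃ lam.cells) (T' : Fin N ≃ μ.cells)
    (h : ∀ x y, rowOf T x = rowOf T y → colOf T' x = colOf T' y → x = y) :
    ∃ q : Perm (Fin N), (∀ m, colOf T' (q m) = colOf T' m) ∧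
      ∀ m, rowOf T' (q m) ≤ rowOf T m := by
  classical
  -- The size of `B x` is the rank of `x` when its column of `T'` is ordered by the rows of `T`; the
  -- sorting `φ` sends `x` to the row of that rank. By `h` the entries counted lie in distinct rows
  -- of `T`, so the rank is at most the row of `x` in `T`.
  let B : Fin N → Finset (Fin N) := fun x =>
    Finset.univ.filter (fun y => colOf T' y = colOf T' x ∧ rowOf T y < rowOf T x)
  have hBrow : ∀ x, (B x).card ≤ rowOf T x := fun x => by
    have : ((B x).image (rowOf T)).card = (B x).card := by
      apply Finset.card_image_of_injOn
      intro y hy z hz hyz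
      simp only [B, Finset.coe_filter, Finset.mem_univ, true_and, Set.mem_ofPred_eq] at hy hz
      exact h y z hyz (hy.1.trans hz.1.symm)
    rw [← this, ← Finset.card_range (rowOf T x)]
    apply Finset.card_le_card
    intro r hr
    simp only [B, Finset.mem_image, Finset.mem_filter, Finset.mem_univ, true_and] at hr
    obtain ⟨y, hy, rfl⟩ := hr
    exact Finset.mem_range.mpr hy.2
  have hBcol : ∀ x, ((B x).card, colOf T' x) ∈ μ := fun x => by
    have hlt : (B x).card <
        (Finset.univ.filter (fun y => colOf T' y = colOf T' x)).card := by
      apply Finset.card_lt_card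
      refine ⟨fun y hy => ?_, fun hs => ?_⟩
      · simp only [B, Finset.mem_filter, Finset.mem_univ, true_and] at hy ⊢
        exact hy.1
      · have := hs (by simp : x ∈ _)
        simp [B] at this
    rw [YoungDiagram.mem_iff_lt_colLen]
    refine hlt.trans_le ?_
    have : ((Finset.univ.filter (fun y => colOf T' y = colOf T' x)).image (rowOf T')).card =
        (Finset.univ.filter (fun y => colOf T' y = colOf T' x)).card := by
      apply Finset.card_image_of_injOn
      intro y hy z hz hyz
      simp only [Finset.coe_filter, Finset.mem_univ, true_and, Set.mem_ofPred_eq] at hy hz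
      exact row_col_separate T' y z hyz (hy.trans hz.symm)
    rw [← this, ← Finset.card_range (μ.colLen _)]
    apply Finset.card_le_card
    intro r hr
    simp only [Finset.mem_image, Finset.mem_filter, Finset.mem_univ, true_and] at hr
    obtain ⟨y, hy, rfl⟩ := hr
    rw [Finset.mem_range, ← YoungDiagram.mem_iff_lt_colLen, ← hy]
    exact mem_of_tableau T' y
  let φ : Fin N → Fin N := fun x => T'.symm ⟨_, hBcol x⟩
  have hφr : ∀ x, rowOf T' (φ x) = (B x).card := fun x => by simp [φ, rowOf]
  have hφc : ∀ x, colOf T' (φ x) = colOf T' x := fun x => by simp [φ, colOf]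
  have hφ : Function.Injective φ := by
    have aux : ∀ x y, colOf T' x = colOf T' y → rowOf T x < rowOf T y →
        (B x).card < (B y).card := by
      intro x y hc hr
      apply Finset.card_lt_card
      refine ⟨fun z hz => ?_, fun hs => ?_⟩
      · simp only [B, Finset.mem_filter, Finset.mem_univ, true_and] at hz ⊢
        exact ⟨hz.1.trans hc, hz.2.trans hr⟩
      · have := hs (by simp [B, hc, hr] : x ∈ B y)
        simp [B] at this
    intro x y hxy
    have hr : (B x).card = (B y).card := by rw [← hφr, ← hφr, hxy]
    have hc : colOf T' x = colOf T' y := by rw [← hφc x, ← hφc y, hxy]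
    rcases lt_trichotomy (rowOf T x) (rowOf T y) with h1 | h1 | h1
    · exact absurd hr (aux x y hc h1).ne
    · exact h x y h1 hc
    · exact absurd hr (aux y x hc.symm h1).ne'
  refine ⟨Equiv.ofBijective φ (Finite.injective_iff_bijective.mp hφ), hφc, fun m => ?_⟩
  exact (hφr m).trans_le (hBrow m)

/-- The sum of the row indices of the cells of a Young diagram. -/
def rowWeight (μ : YoungDiagram) : ℕ := ∑ c ∈ μ.cells, c.1

theorem sum_rowOf (T : Fin N ≃ μ.cells) : ∑ m, rowOf T m = rowWeight μ := by
  rw [rowWeight, ← Finset.sum_coe_sort μ.cells (fun c => c.1)]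
  exact Equiv.sum_comp T (fun c : μ.cells => c.1.1)

/-- The pointwise inequality of the sorting becomes an equality once the totals are compared. The
numerical weight plays the role of the dominance order and, unlike it, makes any two diagrams
comparable. -/
theorem exists_column_sort_eq (T : Fin N ≃ lam.cells) (T' : Fin N ≃ μ.cells)
    (hw : rowWeight lam ≤ rowWeight μ)
    (h : ∀ x y, rowOf T x = rowOf T y → colOf T' x = colOf T' y → x = y) :
    ∃ q : Perm (Fin N), (∀ m, colOf T' (q m) = colOf T' m) ∧
      ∀ m, rowOf T' (q m) = rowOf T m := by
  obtain ⟨q, hq, hle⟩ := exists_column_sort T T' h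
  refine ⟨q, hq, fun m => ?_⟩
  have hs : ∑ m, rowOf T' (q m) = ∑ m, rowOf T m := by
    apply le_antisymm (Finset.sum_le_sum fun m _ => hle m)
    rw [Equiv.sum_comp q (rowOf T'), sum_rowOf, sum_rowOf]
    exact hw
  exact (Finset.sum_eq_sum_iff_of_le fun m _ => hle m).mp hs m (Finset.mem_univ m)

theorem card_rowOf_eq (T : Fin N ≃ μ.cells) (r : ℕ) :
    (Finset.univ.filter (fun m => rowOf T m = r)).card = μ.rowLen r := by
  rw [YoungDiagram.rowLen_eq_card]
  refine Finset.card_bij (fun m _ => (T m).1) ?_ ?_ ?_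
  · intro m hm
    rw [YoungDiagram.mem_row_iff]
    exact ⟨(T m).2, (Finset.mem_filter.mp hm).2⟩
  · intro x _ y _ hxy
    exact T.injective (Subtype.ext hxy)
  · intro c hc
    rw [YoungDiagram.mem_row_iff] at hc
    exact ⟨T.symm ⟨c, hc.1⟩,
      Finset.mem_filter.mpr ⟨Finset.mem_univ _, by simp [rowOf, hc.2]⟩, by simp⟩

theorem card_colOf_eq (T : Fin N ≃ μ.cells) (s : ℕ) :
    (Finset.univ.filter (fun m => colOf T m = s)).card = μ.colLen s := by
  rw [YoungDiagram.colLen_eq_card]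
  refine Finset.card_bij (fun m _ => (T m).1) ?_ ?_ ?_
  · intro m hm
    rw [YoungDiagram.mem_col_iff]
    exact ⟨(T m).2, (Finset.mem_filter.mp hm).2⟩
  · intro x _ y _ hxy
    exact T.injective (Subtype.ext hxy)
  · intro c hc
    rw [YoungDiagram.mem_col_iff] at hc
    exact ⟨T.symm ⟨c, hc.1⟩,
      Finset.mem_filter.mpr ⟨Finset.mem_univ _, by simp [colOf, hc.2]⟩, by simp⟩

theorem eq_of_rowLen_eq (h : ∀ r, lam.rowLen r = μ.rowLen r) : lam = μ := by
  ext ⟨r, s⟩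
  rw [YoungDiagram.mem_cells, YoungDiagram.mem_cells, YoungDiagram.mem_iff_lt_rowLen,
    YoungDiagram.mem_iff_lt_rowLen, h]

theorem card_image_rowOf (T : Fin N ≃ μ.cells) :
    (Finset.univ.image (rowOf T)).card = μ.colLen 0 := by
  rw [← Finset.card_range (μ.colLen 0)]
  congr 1
  ext r
  rw [Finset.mem_range, ← YoungDiagram.mem_iff_lt_colLen]
  simp only [Finset.mem_image, Finset.mem_univ, true_and]
  constructor
  · rintro ⟨x, rfl⟩
    exact μ.up_left_mem le_rfl (Nat.zero_le _) (mem_of_tableau T x)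
  · intro h
    obtain ⟨x, hx, -⟩ := exists_of_mem T h
    exact ⟨x, hx⟩

theorem card_image_colOf (T : Fin N ≃ μ.cells) :
    (Finset.univ.image (colOf T)).card = μ.rowLen 0 := by
  rw [← Finset.card_range (μ.rowLen 0)]
  congr 1
  ext r
  rw [Finset.mem_range, ← YoungDiagram.mem_iff_lt_rowLen]
  simp only [Finset.mem_image, Finset.mem_univ, true_and]
  constructor
  · rintro ⟨x, rfl⟩
    exact μ.up_left_mem (Nat.zero_le _) le_rfl (mem_of_tableau T x)
  · intro h
    obtain ⟨x, -, hx⟩ := exists_of_mem T h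
    exact ⟨x, hx⟩

/-- The transposition $(x\;y)$, inserted between the two factors, fixes the row sum and negates the
column sum. -/
theorem rowSum_mul_colSum_eq_zero (T : Fin N ≃ lam.cells) (T' : Fin N ≃ μ.cells) {x y : Fin N}
    (hxy : x ≠ y) (hr : rowOf T x = rowOf T y) (hc : colOf T' x = colOf T' y) :
    rowSum T * colSum T' = 0 := by
  have h1 : rowSum T * perm (swap x y) = rowSum T := by
    rw [rowSum_eq_fiberSum, fiberSum_mul_perm _ _ (preserves_swap hr)]; simp
  have h2 : perm (swap x y) * colSum T' = -colSum T' := by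
    rw [colSum_eq_fiberSum, perm_mul_fiberSum _ _ (preserves_swap hc), Perm.sign_swap hxy]; simp
  have h3 : rowSum T * colSum T' = -(rowSum T * colSum T') := by
    conv_lhs => rw [← h1, mul_assoc, h2, mul_neg]
  have h4 : (2 : ℂ) • (rowSum T * colSum T') = 0 := by
    rw [two_smul]; nth_rewrite 1 [h3]; exact neg_add_cancel _
  exact (smul_eq_zero.mp h4).resolve_left two_ne_zero

/-- The tableau with entries relabelled by a permutation. -/
def relabel (g : Perm (Fin N)) (T : Fin N ≃ μ.cells) : Fin N ≃ μ.cells := g⁻¹.trans T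

theorem perm_mul_colSum (g : Perm (Fin N)) (T : Fin N ≃ μ.cells) :
    perm g * colSum T = colSum (relabel g T) * perm g := by
  rw [colSum_eq_fiberSum, colSum_eq_fiberSum, perm_mul_fiberSum_mul_perm_inv]
  rfl

/-- For $x$ a permutation $g$, either two entries share a row of $T$ and a column of $gT'$, or
sorting matches the rows of $T$ with those of $gT'$, which forces equal shapes. -/
theorem rowSum_mul_mul_colSum_eq_zero (T : Fin N ≃ lam.cells) (T' : Fin N ≃ μ.cells)
    (hw : rowWeight lam ≤ rowWeight μ) (hne : lam ≠ μ) (x : SymAlg N) :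
    rowSum T * x * colSum T' = 0 := by
  induction x using MonoidAlgebra.induction_on with
  | of g =>
    change rowSum T * perm g * colSum T' = 0
    rw [mul_assoc, perm_mul_colSum, ← mul_assoc]
    by_cases h : ∀ x y, rowOf T x = rowOf T y →
        colOf (relabel g T') x = colOf (relabel g T') y → x = y
    · obtain ⟨q, -, hq⟩ := exists_column_sort_eq T (relabel g T') hw h
      refine absurd (eq_of_rowLen_eq fun r => ?_) hne
      rw [← card_rowOf_eq T, ← card_rowOf_eq (relabel g T')]
      refine Finset.card_bij (fun m _ => q m) ?_ ?_ ?_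
      · intro m; simp [hq]
      · intro a _ b _ hab; exact q.injective hab
      · intro m hm; exact ⟨q⁻¹ m, by simpa [← hq] using hm, by simp⟩
    · push Not at h
      obtain ⟨x, y, hr, hc, hxy⟩ := h
      rw [rowSum_mul_colSum_eq_zero T _ hxy hr hc, zero_mul]
  | add a b ha hb => rw [mul_add, add_mul, ha, hb, add_zero]
  | smul r a ha => rw [mul_smul_comm, smul_mul_assoc, ha, smul_zero]

theorem rowSum_mul_mul_colSum (T : Fin N ≃ μ.cells) (x : SymAlg N) :
    ∃ z : ℂ, rowSum T * x * colSum T = z • youngSymmetrizer T := by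
  induction x using MonoidAlgebra.induction_on with
  | of g =>
    change ∃ z : ℂ, rowSum T * perm g * colSum T = z • youngSymmetrizer T
    by_cases h : ∀ x y, rowOf T x = rowOf T y →
        colOf (relabel g T) x = colOf (relabel g T) y → x = y
    · obtain ⟨q, hqc, hqr⟩ := exists_column_sort_eq T (relabel g T) le_rfl h
      have hp : ∀ m, rowOf T (g⁻¹ (q m)) = rowOf T m := hqr
      have hq : ∀ m, colOf T (g⁻¹ (q (g m))) = colOf T m := fun m => by
        have := hqc (g m)
        simpa [relabel, colOf] using this
      -- Without a collision $g=p^{-1}(pg)$, where $p$ preserves the rows of $T$ and $pg$ its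
      -- columns; the two sums absorb these factors up to the sign of $pg$.
      obtain ⟨p, hpdef⟩ : ∃ p, p = g⁻¹ * q := ⟨_, rfl⟩
      have hg' : g = p⁻¹ * (p * g) := by group
      have hpr : ∀ m, rowOf T (p⁻¹ m) = rowOf T m := fun m => by
        rw [← hp (p⁻¹ m), hpdef]; simp
      have hpc : ∀ m, colOf T ((p * g) m) = colOf T m := fun m => by
        rw [hpdef]; exact hq m
      refine ⟨((Perm.sign (p * g) : ℤ) : ℂ), ?_⟩
      rw [youngSymmetrizer, hg', ← perm_mul, ← mul_assoc, rowSum_eq_fiberSum,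
        fiberSum_mul_perm _ _ hpr, colSum_eq_fiberSum, mul_assoc, perm_mul_fiberSum _ _ hpc,
        mul_smul_comm]
      simp
    · push Not at h
      obtain ⟨x, y, hr, hc, hxy⟩ := h
      refine ⟨0, ?_⟩
      rw [mul_assoc, perm_mul_colSum, ← mul_assoc, rowSum_mul_colSum_eq_zero T _ hxy hr hc,
        zero_mul, zero_smul]
  | add a b ha hb =>
    obtain ⟨z, hz⟩ := ha
    obtain ⟨w, hw⟩ := hb
    exact ⟨z + w, by rw [mul_add, add_mul, hz, hw, add_smul]⟩
  | smul r a ha =>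
    obtain ⟨z, hz⟩ := ha
    exact ⟨r * z, by rw [mul_smul_comm, smul_mul_assoc, hz, smul_smul]⟩

theorem youngSymmetrizer_ne_zero (T : Fin N ≃ μ.cells) : youngSymmetrizer T ≠ 0 := by
  intro h
  have := coeffOne_fiberSum_mul (row_col_separate T) 1 Perm.sign
  rw [← rowSum_eq_fiberSum, ← colSum_eq_fiberSum] at this
  rw [youngSymmetrizer] at h
  rw [h, map_zero] at this
  exact zero_ne_one this

end YoungRep

/-! ### Irreducible representations of the symmetric group as Specht ideals -/

namespace YoungRep

open Equiv (Perm swap)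

variable {N : ℕ} {lam μ : YoungDiagram}

/-- The left ideal generated by the Young symmetrizer. -/
abbrev specht (T : Fin N ≃ μ.cells) : Ideal (SymAlg N) := Ideal.span {youngSymmetrizer T}

/-- By semisimplicity $U$ is generated by an idempotent $e=x\,c_T$, and then $e=e\cdot e=x\,(c_T
e)=0$. -/
theorem eq_bot_of_youngSymmetrizer_mul (T : Fin N ≃ μ.cells) {U : Ideal (SymAlg N)}
    (hU : U ≤ specht T) (h : ∀ u ∈ U, youngSymmetrizer T * u = 0) : U = ⊥ := by
  obtain ⟨e, he, rfl⟩ := IsSemisimpleRing.ideal_eq_span_idempotent U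
  have heU : e ∈ Ideal.span {e} := Ideal.mem_span_singleton_self e
  obtain ⟨x, hx⟩ := Ideal.mem_span_singleton'.mp (hU heU)
  have : e = 0 := by
    rw [← he.eq]
    nth_rewrite 1 [← hx]
    rw [mul_assoc, h e heU, mul_zero]
  rw [this, Ideal.span_singleton_eq_bot]

theorem youngSymmetrizer_mul_mem (T : Fin N ≃ μ.cells) {u : SymAlg N} (hu : u ∈ specht T) :
    ∃ z : ℂ, youngSymmetrizer T * u = z • youngSymmetrizer T := by
  obtain ⟨x, rfl⟩ := Ideal.mem_span_singleton'.mp hu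
  obtain ⟨z, hz⟩ := rowSum_mul_mul_colSum T (colSum T * x * rowSum T)
  exact ⟨z, by rw [← hz, youngSymmetrizer]; noncomm_ring⟩

theorem youngSymmetrizer_mul_eq_zero (T : Fin N ≃ lam.cells) (T' : Fin N ≃ μ.cells)
    (hw : rowWeight lam ≤ rowWeight μ) (hne : lam ≠ μ) {u : SymAlg N} (hu : u ∈ specht T') :
    youngSymmetrizer T * u = 0 := by
  obtain ⟨x, rfl⟩ := Ideal.mem_span_singleton'.mp hu
  rw [← rowSum_mul_mul_colSum_eq_zero T T' hw hne (colSum T * x * rowSum T'), youngSymmetrizer,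
    youngSymmetrizer]
  noncomm_ring

/-- If $c_T u=z\,c_T$ with $z\ne0$ for some $u\in U$, then $c_T\in U$ and $U$ is not proper.
Otherwise $c_T$ kills $U$, hence $U=0$. -/
theorem isAtom_specht (T : Fin N ≃ μ.cells) : IsAtom (specht T) := by
  refine ⟨fun h => youngSymmetrizer_ne_zero T (Ideal.span_singleton_eq_bot.mp h),
    fun U hU => eq_bot_of_youngSymmetrizer_mul T hU.le fun u hu => ?_⟩
  obtain ⟨z, hz⟩ := youngSymmetrizer_mul_mem T (hU.le hu)
  by_cases h0 : z = 0
  · rw [hz, h0, zero_smul]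
  · refine absurd ((Ideal.span_singleton_le_iff_mem U).mpr ?_) hU.not_ge
    have : youngSymmetrizer T = (algebraMap ℂ (SymAlg N) z⁻¹ * youngSymmetrizer T) * u := by
      rw [mul_assoc, hz, ← Algebra.smul_def, smul_smul, inv_mul_cancel₀ h0, one_smul]
    rw [this]
    exact U.mul_mem_left _ hu

instance (T : Fin N ≃ μ.cells) : IsSimpleModule (SymAlg N) (specht T) :=
  isSimpleModule_iff_isAtom.mpr (isAtom_specht T)

theorem isEmpty_specht_equiv (T : Fin N ≃ lam.cells) (T' : Fin N ≃ μ.cells) (hne : lam ≠ μ) :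
    IsEmpty (specht T ≃ₗ[SymAlg N] specht T') := by
  have aux : ∀ {lam μ : YoungDiagram} (T : Fin N ≃ lam.cells) (T' : Fin N ≃ μ.cells)
      (_ : lam ≠ μ) (_ : rowWeight lam ≤ rowWeight μ),
      (specht T ≃ₗ[SymAlg N] specht T') → False := by
    -- The symmetrizer of `T` kills the ideal of `T'`; an isomorphism would make it kill its own
    -- nonzero ideal.
    intro lam μ T T' hne hw φ
    refine (isAtom_specht T).1 (eq_bot_of_youngSymmetrizer_mul T le_rfl fun u hu => ?_)
    have h1 : φ (youngSymmetrizer T • (⟨u, hu⟩ : specht T)) = 0 := by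
      rw [map_smul]
      exact Subtype.ext (youngSymmetrizer_mul_eq_zero T T' hw hne (φ ⟨u, hu⟩).2)
    exact congrArg Subtype.val ((LinearEquiv.map_eq_zero_iff φ).mp h1)
  refine ⟨fun φ => ?_⟩
  rcases le_total (rowWeight lam) (rowWeight μ) with h | h
  · exact aux T T' hne h φ
  · exact aux T' T hne.symm h φ.symm

/-- The representation of the symmetric group on the left ideal of a Young symmetrizer. -/
def spechtRep (T : Fin N ≃ μ.cells) : Representation ℂ (Perm (Fin N)) (specht T) :=
  Representation.ofModule' (specht T)

theorem spechtRep_apply (T : Fin N ≃ μ.cells) (p : Perm (Fin N)) (u : specht T) :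
    spechtRep T p u = perm p • u := rfl

theorem spechtRep_asAlgebraHom (T : Fin N ≃ μ.cells) (x : SymAlg N) (u : specht T) :
    (spechtRep T).asAlgebraHom x u = x • u := by
  induction x using MonoidAlgebra.induction_on with
  | of g => rw [Representation.asAlgebraHom_of, spechtRep_apply]
  | add a b ha hb => rw [map_add, LinearMap.add_apply, ha, hb, add_smul]
  | smul r a ha => rw [map_smul, LinearMap.smul_apply, ha, smul_assoc]

/-- The module of `spechtRep T` is the left ideal itself. -/
def spechtRepAsModule (T : Fin N ≃ μ.cells) :
    (spechtRep T).asModule ≃ₗ[SymAlg N] specht T where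
  toAddEquiv := (spechtRep T).asModuleEquiv.toAddEquiv
  map_smul' x u := by
    change (spechtRep T).asModuleEquiv (x • u) = x • (spechtRep T).asModuleEquiv u
    rw [Representation.asModuleEquiv_map_smul, spechtRep_asAlgebraHom]

instance (T : Fin N ≃ μ.cells) : (spechtRep T).IsIrreducible :=
  (Representation.irreducible_iff_isSimpleModule_asModule _).mpr
    (IsSimpleModule.congr (spechtRepAsModule T))

/-- An isomorphism of representations as an isomorphism of modules over the group algebra. -/
def asModuleEquivOfEquiv {V V' : Type*} [AddCommGroup V] [Module ℂ V] [AddCommGroup V']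
    [Module ℂ V'] {G : Type*} [Group G] {ρ : Representation ℂ G V} {ρ' : Representation ℂ G V'}
    (φ : Representation.Equiv ρ ρ') : ρ.asModule ≃ₗ[MonoidAlgebra ℂ G] ρ'.asModule :=
  LinearEquiv.ofBijective
    (Representation.IntertwiningMap.equivLinearMapAsModule ρ ρ' φ.toIntertwiningMap)
    (EquivLike.bijective φ)

instance (T : Fin N ≃ μ.cells) : FiniteDimensional ℂ (specht T) :=
  FiniteDimensional.finiteDimensional_submodule ((specht T).restrictScalars ℂ)

theorem card_cellsOfRowLens (w : List ℕ) : (YoungDiagram.cellsOfRowLens w).card = w.sum := by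
  induction w with
  | nil => rfl
  | cons a w ih =>
    rw [YoungDiagram.cellsOfRowLens, Finset.card_union_of_disjoint, List.sum_cons]
    · simp [ih]
    · rw [Finset.disjoint_left]
      rintro ⟨i, j⟩ h1 h2
      simp at h1 h2
      omega

/-- The Young diagrams with `N` cells. -/
abbrev Diagrams (N : ℕ) : Type := {μ : YoungDiagram // μ.cells.card = N}

/-- A tableau of given shape. -/
def tableau (μ : Diagrams N) : Fin N ≃ μ.1.cells := (Finset.equivFinOfCardEq μ.2).symm

/-- The Young diagram whose rows are the cycle lengths of a permutation. -/
def cycleDiagram (p : Perm (Fin N)) : Diagrams N :=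
  ⟨YoungDiagram.ofRowLens (p.partition.parts.sort (· ≥ ·))
    (Multiset.pairwise_sort _ _).sortedGE, by
    change (YoungDiagram.cellsOfRowLens _).card = N
    rw [card_cellsOfRowLens, ← Multiset.sum_coe, Multiset.sort_eq, p.partition.parts_sum,
      Fintype.card_fin]⟩

theorem isConj_of_cycleDiagram_eq {p q : Perm (Fin N)} (h : cycleDiagram p = cycleDiagram q) :
    IsConj p q := by
  have h1 := congrArg (fun μ : Diagrams N => μ.1.rowLens) h
  have hpos : ∀ p : Perm (Fin N), ∀ x ∈ p.partition.parts.sort (· ≥ ·), 0 < x := by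
    intro p x hx
    exact p.partition.parts_pos ((Multiset.mem_sort _).mp hx)
  simp only [cycleDiagram] at h1
  rw [YoungDiagram.rowLens_ofRowLens_eq_self (hpos p),
    YoungDiagram.rowLens_ofRowLens_eq_self (hpos q)] at h1
  rw [Perm.partition_eq_of_isConj]
  apply Nat.Partition.ext
  rw [← Multiset.sort_eq p.partition.parts (· ≥ ·), h1, Multiset.sort_eq]

/-- The cycle type, read as a diagram, determines the class. Finiteness is assumed because
`Nat.card` of an infinite type is zero; it is supplied later by linear independence of characters.
-/
theorem card_conjClasses_le [Finite (Diagrams N)] :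
    Nat.card (ConjClasses (Perm (Fin N))) ≤ Nat.card (Diagrams N) := by
  refine Nat.card_le_card_of_injective
    (fun C : ConjClasses (Perm (Fin N)) => cycleDiagram (Quotient.out C)) fun C D h => ?_
  have h1 := isConj_of_cycleDiagram_eq h
  have := ConjClasses.mk_eq_mk_iff_isConj.mpr h1
  exact (Quotient.out_eq C).symm.trans (this.trans (Quotient.out_eq D))

theorem linearIndependent_of_char_orthonormal {G ι : Type*} [Group G] [Fintype G]
    [DecidableEq ι]
    (χ : ι → ConjClasses G → ℂ)
    (h : ∀ i j, (Nat.card G : ℂ)⁻¹ *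
      ∑ g : G, χ i (ConjClasses.mk g) * χ j (ConjClasses.mk g⁻¹) = if i = j then 1 else 0) :
    LinearIndependent ℂ χ := by
  rw [linearIndependent_iff']
  intro s a ha j hj
  have h1 : (Nat.card G : ℂ)⁻¹ * ∑ g : G, (∑ i ∈ s, a i • χ i) (ConjClasses.mk g) *
      χ j (ConjClasses.mk g⁻¹) = a j := by
    simp only [Finset.sum_apply, Pi.smul_apply, smul_eq_mul, Finset.sum_mul]
    rw [Finset.sum_comm, Finset.mul_sum]
    rw [Finset.sum_congr rfl (g := fun i => a i * if i = j then 1 else 0)]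
    · simp [hj]
    · intro i _
      rw [← h i j, Finset.mul_sum, Finset.mul_sum, Finset.mul_sum]
      exact Finset.sum_congr rfl fun g _ => by ring
  rw [← h1, ha]
  simp

theorem classCharacter_mk {G V : Type*} [Group G] [AddCommGroup V] [Module ℂ V]
    (ρ : Representation ℂ G V) (g : G) : classCharacter ρ (ConjClasses.mk g) = ρ.character g := rfl

/-- Every irreducible representation of the symmetric group corresponds to a Young diagram. -/
theorem exists_correspondsTo {W : Type*} [AddCommGroup W] [Module ℂ W] [FiniteDimensional ℂ W]
    (ρW : Representation ℂ (Perm (Fin N)) W) (hW : ρW.IsIrreducible) :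
    ∃ μ, CorrespondsTo ρW μ := by
  classical
  by_contra hno
  -- If `ρW` matched no diagram, its character together with the Specht characters would be
  -- orthonormal class functions, one more than there are diagrams, while there are at most as many
  -- classes as diagrams.
  let χ : Option (Diagrams N) → ConjClasses (Perm (Fin N)) → ℂ := fun o =>
    o.elim (classCharacter ρW) fun μ => classCharacter (spechtRep (tableau μ))
  let _ : Invertible (Nat.card (Perm (Fin N)) : ℂ) :=
    invertibleOfNonzero (Nat.cast_ne_zero.mpr Nat.card_pos.ne')
  have hWs : ∀ μ : Diagrams N, ¬ Nonempty (Representation.Equiv ρW (spechtRep (tableau μ))) := by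
    rintro μ ⟨φ⟩
    exact hno ⟨μ.1, tableau μ, ⟨(asModuleEquivOfEquiv φ).trans (spechtRepAsModule _)⟩⟩
  have hsW : ∀ μ : Diagrams N, ¬ Nonempty (Representation.Equiv (spechtRep (tableau μ)) ρW) := by
    rintro μ ⟨φ⟩
    exact hWs μ ⟨φ.symm⟩
  have hss : ∀ lam μ : Diagrams N, lam ≠ μ →
      ¬ Nonempty (Representation.Equiv (spechtRep (tableau lam)) (spechtRep (tableau μ))) := by
    rintro lam μ hne ⟨φ⟩
    exact (isEmpty_specht_equiv (tableau lam) (tableau μ) fun h => hne (Subtype.ext h)).false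
      ((spechtRepAsModule _).symm.trans ((asModuleEquivOfEquiv φ).trans (spechtRepAsModule _)))
  have hli : LinearIndependent ℂ χ := by
    refine linearIndependent_of_char_orthonormal χ fun i j => ?_
    rcases i with _ | lam <;> rcases j with _ | μ
    · simp only [χ, Option.elim, classCharacter_mk]
      rw [Representation.char_orthonormal, if_pos ⟨.refl _⟩]; simp
    · simp only [χ, Option.elim, classCharacter_mk]
      rw [Representation.char_orthonormal, if_neg (hsW μ), if_neg (by simp)]
    · simp only [χ, Option.elim, classCharacter_mk]
      rw [Representation.char_orthonormal, if_neg (hWs lam), if_neg (by simp)]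
    · simp only [χ, Option.elim, classCharacter_mk]
      rw [Representation.char_orthonormal]
      by_cases h : lam = μ
      · subst h
        rw [if_pos ⟨.refl _⟩, if_pos rfl]
      · rw [if_neg (hss μ lam (Ne.symm h)), if_neg (by simpa using h)]
  have : Finite (Option (Diagrams N)) := hli.finite
  have : Finite (Diagrams N) := Finite.of_injective some (Option.some_injective _)
  have := Fintype.ofFinite (Option (Diagrams N))
  have h1 := hli.fintype_card_le_finrank
  rw [Module.finrank_pi, ← Nat.card_eq_fintype_card, ← Nat.card_eq_fintype_card,
    Finite.card_option] at h1
  have h2 := card_conjClasses_le (N := N)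
  omega

end YoungRep

/-! ### Rectangular diagrams and scalar action of the transposition sums -/

namespace YoungRep

open Equiv (Perm swap)

variable {N : ℕ} {μ : YoungDiagram}

theorem coeffOne_mul_comm (x y : SymAlg N) : coeffOne (x * y) = coeffOne (y * x) := by
  induction x using MonoidAlgebra.induction_on with
  | of p =>
    induction y using MonoidAlgebra.induction_on with
    | of q =>
      change coeffOne (perm p * perm q) = coeffOne (perm q * perm p)
      rw [perm_mul, perm_mul, coeffOne_perm, coeffOne_perm]
      simp only [mul_eq_one_comm]
    | add a b ha hb => rw [mul_add, add_mul, map_add, map_add, ha, hb]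
    | smul r a ha => rw [mul_smul_comm, smul_mul_assoc, map_smul, map_smul, ha]
  | add a b ha hb => rw [mul_add, add_mul, map_add, map_add, ha, hb]
  | smul r a ha => rw [mul_smul_comm, smul_mul_assoc, map_smul, map_smul, ha]

theorem fiberSum_mul_self (χ : Perm (Fin N) →* ℤˣ) (f : Fin N → ℕ) :
    ∃ n : ℕ, n ≠ 0 ∧ fiberSum χ f * fiberSum χ f = (n : ℂ) • fiberSum χ f := by
  classical
  refine ⟨(Finset.univ.filter (fun p : Perm (Fin N) => ∀ m, f (p m) = f m)).card,
    Finset.card_ne_zero.mpr ⟨1, by simp⟩, ?_⟩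
  nth_rewrite 1 [fiberSum]
  rw [Finset.sum_mul, Nat.cast_smul_eq_nsmul, ← Finset.sum_const]
  refine Finset.sum_congr (by congr!) fun p hp => ?_
  rw [smul_mul_assoc, perm_mul_fiberSum χ f (by simpa using hp), smul_smul, sign_mul_self,
    one_smul]

/-- Writing $r$, $q$ for the row and column sums, the coefficient of the identity is a trace, so on
$q\,(rq)$ it equals that on $r\,q^2=n\,rq$, namely $n\neq0$. -/
theorem colSum_mul_youngSymmetrizer_ne_zero (T : Fin N ≃ μ.cells) :
    colSum T * youngSymmetrizer T ≠ 0 := by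
  intro h
  obtain ⟨n, hn, hb⟩ := fiberSum_mul_self Perm.sign (colOf T)
  have h1 := coeffOne_mul_comm (colSum T) (youngSymmetrizer T)
  rw [h, map_zero, youngSymmetrizer, mul_assoc, rowSum_eq_fiberSum, colSum_eq_fiberSum, hb,
    mul_smul_comm, map_smul, coeffOne_fiberSum_mul (row_col_separate T)] at h1
  simp [eq_comm, hn] at h1

theorem star_mul_youngSymmetrizer (T : Fin N ≃ μ.cells) (i : Fin N)
    (h : ∀ x, rowOf T x = rowOf T i → ∀ z, (rowOf T z, colOf T x) ∈ μ) :
    star i * youngSymmetrizer T =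
      ((μ.rowLen (rowOf T i) : ℂ) - (μ.colLen 0 : ℂ)) • youngSymmetrizer T := by
  have := star_mul_fiberSum_mul (row_col_separate T) (χ := 1) (ψ := Perm.sign) (ε := 1)
    (by simp) (by intro x y hxy; rw [Perm.sign_swap hxy]) (i := i)
    (fun x hx z => exists_of_mem T (h x hx z))
  rw [youngSymmetrizer, rowSum_eq_fiberSum, colSum_eq_fiberSum, this, card_rowOf_eq,
    card_image_rowOf]
  simp

/-- The transposed computation: rows and columns exchange roles and $\varepsilon=-1$. Its hypothesis
holds for `i` in the last column. -/
theorem star_mul_colSum_mul_rowSum (T : Fin N ≃ μ.cells) (i : Fin N)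
    (h : ∀ x, colOf T x = colOf T i → ∀ z, (rowOf T x, colOf T z) ∈ μ) :
    star i * (colSum T * rowSum T) =
      ((μ.rowLen 0 : ℂ) - (μ.colLen (colOf T i) : ℂ)) • (colSum T * rowSum T) := by
  have := star_mul_fiberSum_mul (f := colOf T) (g := rowOf T)
    (fun x y hc hr => row_col_separate T x y hr hc) (χ := Perm.sign) (ψ := 1) (ε := -1)
    (by intro x y hxy; rw [Perm.sign_swap hxy]) (by simp) (i := i)
    (fun x hx z => (exists_of_mem T (h x hx z)).imp fun y hy => hy.symm)
  rw [rowSum_eq_fiberSum, colSum_eq_fiberSum, this, card_colOf_eq, card_image_colOf]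
  simp

theorem mem_rect {a b i j : ℕ} : (i, j) ∈ rect a b ↔ i < a ∧ j < b := by
  rw [← YoungDiagram.mem_cells]
  simp [rect]

/-- In a rectangle every entry satisfies the condition of `star_mul_youngSymmetrizer`, with the same
eigenvalue. Moving `star i` past a permutation only changes `i`, so the eigenvalue persists on the
whole left ideal. -/
theorem star_mul_of_mem_specht_rect {a b : ℕ} (T : Fin N ≃ (rect a b).cells) (i : Fin N)
    {u : SymAlg N} (hu : u ∈ specht T) : star i * u = ((b : ℂ) - (a : ℂ)) • u := by
  have hc : ∀ i, star i * youngSymmetrizer T = ((b : ℂ) - (a : ℂ)) • youngSymmetrizer T := by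
    intro i
    have hi := mem_rect.mp (mem_of_tableau T i)
    rw [star_mul_youngSymmetrizer T i fun x _ z => mem_rect.mpr
      ⟨(mem_rect.mp (mem_of_tableau T z)).1, (mem_rect.mp (mem_of_tableau T x)).2⟩]
    have hrow : (rect a b).rowLen (rowOf T i) = b := by
      refine eq_of_forall_lt_iff fun j => ?_
      rw [← YoungDiagram.mem_iff_lt_rowLen, mem_rect]
      exact and_iff_right hi.1
    have hcol : (rect a b).colLen 0 = a := by
      refine eq_of_forall_lt_iff fun j => ?_
      rw [← YoungDiagram.mem_iff_lt_colLen, mem_rect]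
      exact and_iff_left (Nat.zero_lt_of_lt hi.2)
    rw [hrow, hcol]
  obtain ⟨x, rfl⟩ := Ideal.mem_span_singleton'.mp hu
  clear hu
  induction x using MonoidAlgebra.induction_on with
  | of p =>
    change star i * (perm p * _) = _ • (perm p * _)
    have := perm_mul_star p (p⁻¹ i)
    rw [show p (p⁻¹ i) = i by simp] at this
    rw [← mul_assoc, ← this, mul_assoc, hc, mul_smul_comm]
  | add a b ha hb => rw [add_mul, mul_add, ha, hb, smul_add]
  | smul r a ha => rw [smul_mul_assoc, mul_smul_comm, ha, smul_comm]

theorem eq_rect_of_star_mul (hN : 1 ≤ N) (T : Fin N ≃ μ.cells) (C : ℂ)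
    (h : ∀ i, ∀ u ∈ specht T, star i * u = C • u) :
    ∃ a b : ℕ, μ = rect a b ∧ C = (b : ℂ) - (a : ℂ) := by
  have h00 : (0, 0) ∈ μ :=
    μ.up_left_mem (Nat.zero_le _) (Nat.zero_le _) (mem_of_tableau T ⟨0, hN⟩)
  have hl : 0 < μ.colLen 0 := YoungDiagram.mem_iff_lt_colLen.mp h00
  have hm : 0 < μ.rowLen 0 := YoungDiagram.mem_iff_lt_rowLen.mp h00
  have hz : ∀ z, rowOf T z ≤ μ.colLen 0 - 1 ∧ colOf T z ≤ μ.rowLen 0 - 1 := fun z => by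
    have hmem := mem_of_tableau T z
    have h1 := YoungDiagram.mem_iff_lt_colLen.mp (μ.up_left_mem le_rfl (Nat.zero_le _) hmem)
    have h2 := YoungDiagram.mem_iff_lt_rowLen.mp (μ.up_left_mem (Nat.zero_le _) le_rfl hmem)
    omega
  -- The entries in the bottom left and top right corners: they lie in the last row and the last
  -- column, and yield two expressions for `C`.
  obtain ⟨i, hi, -⟩ := exists_of_mem T (r := μ.colLen 0 - 1) (s := 0)
    (YoungDiagram.mem_iff_lt_colLen.mpr (by omega))
  obtain ⟨j, -, hj⟩ := exists_of_mem T (r := 0) (s := μ.rowLen 0 - 1)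
    (YoungDiagram.mem_iff_lt_rowLen.mpr (by omega))
  have e1 : C = (μ.rowLen (μ.colLen 0 - 1) : ℂ) - (μ.colLen 0 : ℂ) := by
    have h1 := h i _ (Ideal.mem_span_singleton_self (youngSymmetrizer T))
    rw [star_mul_youngSymmetrizer T i fun x hx z => μ.up_left_mem
      ((hz z).1.trans (by rw [hx, hi])) le_rfl (mem_of_tableau T x), hi] at h1
    exact (smul_left_injective ℂ (youngSymmetrizer_ne_zero T) h1).symm
  have e2 : C = (μ.rowLen 0 : ℂ) - (μ.colLen (μ.rowLen 0 - 1) : ℂ) := by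
    have h1 := h j _ (Ideal.mul_mem_left _ (colSum T)
      (Ideal.mem_span_singleton_self (youngSymmetrizer T)))
    have h2 := star_mul_colSum_mul_rowSum T j fun x hx z => μ.up_left_mem
      le_rfl ((hz z).2.trans (by rw [hx, hj])) (mem_of_tableau T x)
    have h3 : star j * (colSum T * youngSymmetrizer T) =
        ((μ.rowLen 0 : ℂ) - (μ.colLen (μ.rowLen 0 - 1) : ℂ)) •
          (colSum T * youngSymmetrizer T) := by
      rw [youngSymmetrizer, ← mul_assoc (colSum T), ← mul_assoc (star j), h2, smul_mul_assoc, hj]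
    rw [h3] at h1
    exact (smul_left_injective ℂ (colSum_mul_youngSymmetrizer_ne_zero T) h1).symm
  have e3 : μ.rowLen (μ.colLen 0 - 1) + μ.colLen (μ.rowLen 0 - 1) =
      μ.rowLen 0 + μ.colLen 0 := by
    have : ((μ.rowLen (μ.colLen 0 - 1) : ℂ)) + μ.colLen (μ.rowLen 0 - 1) =
        μ.rowLen 0 + μ.colLen 0 := by linear_combination e2 - e1
    exact_mod_cast this
  have h1 := μ.rowLen_anti 0 (μ.colLen 0 - 1) (Nat.zero_le _)
  have h2 := μ.colLen_anti 0 (μ.rowLen 0 - 1) (Nat.zero_le _)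
  -- The last row and column are no longer than the first ones, yet by `e3` the sums of lengths
  -- agree; so both are equalities.
  have h3 : μ.rowLen (μ.colLen 0 - 1) = μ.rowLen 0 := by omega
  refine ⟨μ.colLen 0, μ.rowLen 0, ?_, by rw [e1, h3]⟩
  ext ⟨r, s⟩
  rw [YoungDiagram.mem_cells, YoungDiagram.mem_cells, mem_rect]
  constructor
  · intro hrs
    exact ⟨YoungDiagram.mem_iff_lt_colLen.mp (μ.up_left_mem le_rfl (Nat.zero_le _) hrs),
      YoungDiagram.mem_iff_lt_rowLen.mp (μ.up_left_mem (Nat.zero_le _) le_rfl hrs)⟩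
  · rintro ⟨hr, hs⟩
    rw [← h3, ← YoungDiagram.mem_iff_lt_rowLen] at hs
    exact μ.up_left_mem (by omega) le_rfl hs

variable {W : Type*} [AddCommGroup W] [Module ℂ W]

/-- The action of the sum of the transpositions moving `i`. -/
def starAct (ρW : Representation ℂ (Perm (Fin N)) W) (i : Fin N) : Module.End ℂ W :=
  ∑ j ∈ Finset.univ.filter (fun j => j ≠ i), ρW (swap i j)

theorem asAlgebraHom_star (ρW : Representation ℂ (Perm (Fin N)) W) (i : Fin N) :
    ρW.asAlgebraHom (star i) = starAct ρW i := by
  simp only [star, starAct, map_sum, Representation.asAlgebraHom_of]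

theorem star_smul_of_equiv {ρW : Representation ℂ (Perm (Fin N)) W} {T : Fin N ≃ μ.cells}
    (φ : ρW.asModule ≃ₗ[SymAlg N] specht T) (i : Fin N) (C : ℂ) :
    starAct ρW i = C • 1 ↔ ∀ u ∈ specht T, star i * u = C • u := by
  have hiff : starAct ρW i = C • 1 ↔ ∀ w : ρW.asModule, star i • w = C • w := by
    constructor
    · intro h w
      apply ρW.asModuleEquiv.injective
      rw [Representation.asModuleEquiv_map_smul, asAlgebraHom_star, h, map_smul]
      rfl
    · intro h
      ext w
      have := congrArg ρW.asModuleEquiv (h (ρW.asModuleEquiv.symm w))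
      rw [Representation.asModuleEquiv_map_smul, asAlgebraHom_star, map_smul,
        LinearEquiv.apply_symm_apply] at this
      exact this
  have hsm : ∀ w : ρW.asModule, C • w = (algebraMap ℂ (SymAlg N) C) • w := fun w => by
    rw [algebraMap_smul]
  rw [hiff]
  constructor
  · intro h u hu
    have := congrArg φ (h (φ.symm ⟨u, hu⟩))
    rw [hsm, map_smul, map_smul, LinearEquiv.apply_symm_apply] at this
    rw [Algebra.smul_def]
    exact congrArg Subtype.val this
  · intro h w
    apply φ.injective
    rw [hsm, map_smul, map_smul]
    apply Subtype.ext
    have := h (φ w) (φ w).2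
    rw [Algebra.smul_def] at this
    exact this

/-- The rectangular diagrams are those for which the sums of the transpositions moving a given
point act by scalars. -/
theorem starAct_eq_smul_iff (hN : 1 ≤ N) [FiniteDimensional ℂ W]
    (ρW : Representation ℂ (Perm (Fin N)) W) (hW : ρW.IsIrreducible) (C : ℂ) :
    (∀ i, starAct ρW i = C • 1) ↔
      ∃ a b : ℕ, CorrespondsTo ρW (rect a b) ∧ C = (b : ℂ) - (a : ℂ) := by
  constructor
  · intro h
    obtain ⟨μ, T, ⟨φ⟩⟩ := exists_correspondsTo ρW hW
    obtain ⟨a, b, rfl, hC⟩ := eq_rect_of_star_mul hN T C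
      fun i => (star_smul_of_equiv φ i C).mp (h i)
    exact ⟨a, b, ⟨T, ⟨φ⟩⟩, hC⟩
  · rintro ⟨a, b, ⟨T, ⟨φ⟩⟩, rfl⟩ i
    exact (star_smul_of_equiv φ i _).mpr fun u hu => star_mul_of_mem_specht_rect T i hu

end YoungRep

/-! ### Finite subgroups of $SL(2,\mathbf{C})$ and their centers -/

namespace SympRefl

open Matrix

/-- The underlying matrix of an element of a subgroup of `SL(2, ℂ)`. -/
abbrev mat {Γ : Subgroup (SpecialLinearGroup (Fin 2) ℂ)} (γ : Γ) : Matrix (Fin 2) (Fin 2) ℂ :=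
  ((γ : SpecialLinearGroup (Fin 2) ℂ) : Matrix (Fin 2) (Fin 2) ℂ)

/-- The two determinants give trace $2$, so the characteristic polynomial is $(t-1)^2$. -/
theorem sub_one_mul_self {M : Matrix (Fin 2) (Fin 2) ℂ} (h1 : M.det = 1)
    (h2 : (M - 1).det = 0) : (M - 1) * (M - 1) = 0 := by
  rw [det_fin_two] at h1 h2
  simp at h2
  ext i j
  fin_cases i <;> fin_cases j <;> simp [Matrix.mul_apply, Fin.sum_univ_two]
  · linear_combination M 0 0 * (h1 - h2) - h1
  · linear_combination M 0 1 * (h1 - h2)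
  · linear_combination M 1 0 * (h1 - h2)
  · linear_combination M 1 1 * (h1 - h2) - h1

theorem one_add_pow_of_sq_zero {n : Matrix (Fin 2) (Fin 2) ℂ} (hn : n * n = 0) (k : ℕ) :
    (1 + n) ^ k = 1 + (k : ℂ) • n := by
  induction k with
  | zero => simp
  | succ k ih =>
    rw [pow_succ, ih, add_mul, one_mul, smul_mul_assoc, mul_add, hn, mul_one, add_zero]
    push_cast
    rw [add_smul, one_smul, add_assoc, add_comm n]

theorem trace_sq_eq (M : Matrix (Fin 2) (Fin 2) ℂ) (h1 : M.det = 1) :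
    M * M = M.trace • M - 1 := by
  rw [det_fin_two] at h1
  ext i j
  fin_cases i <;> fin_cases j <;> simp [Matrix.mul_apply, Fin.sum_univ_two, trace_fin_two]
  · linear_combination -h1
  · ring
  · ring
  · linear_combination -h1

variable {Γ : Subgroup (SpecialLinearGroup (Fin 2) ℂ)}

theorem det_mat (γ : Γ) : (mat γ).det = 1 := (γ : SpecialLinearGroup (Fin 2) ℂ).2

theorem mat_mul (γ δ : Γ) : mat (γ * δ) = mat γ * mat δ := rfl

theorem mat_one : mat (1 : Γ) = 1 := rfl

theorem mat_pow (γ : Γ) (k : ℕ) : mat (γ ^ k) = mat γ ^ k := by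
  induction k with
  | zero => rw [pow_zero, pow_zero, mat_one]
  | succ k ih => rw [pow_succ, pow_succ, mat_mul, ih]

theorem mat_injective : Function.Injective (mat : Γ → Matrix (Fin 2) (Fin 2) ℂ) :=
  fun _ _ h => Subtype.ext (Subtype.ext h)

theorem trace_mat_inv (γ : Γ) : (mat γ⁻¹).trace = (mat γ).trace := by
  have : mat γ⁻¹ = (mat γ).adjugate :=
    Matrix.SpecialLinearGroup.coe_inv (γ : SpecialLinearGroup (Fin 2) ℂ)
  rw [this, adjugate_fin_two, trace_fin_two, trace_fin_two]
  simp [add_comm]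

/-- The natural representation on `L`. -/
def natRep (Γ : Subgroup (SpecialLinearGroup (Fin 2) ℂ)) : Representation ℂ Γ L where
  toFun γ := (mat γ).mulVecLin
  map_one' := by rw [mat_one, mulVecLin_one]; rfl
  map_mul' γ δ := by rw [mat_mul, mulVecLin_mul]; rfl

theorem natRep_character (γ : Γ) : (natRep Γ).character γ = (mat γ).trace := by
  rw [Representation.character]
  exact trace_toLin'_eq (mat γ)

variable [Fintype Γ]

/-- Otherwise $\gamma=1+n$ with $n^2=0$, and $1=\gamma^{|\Gamma|}=1+|\Gamma|\,n$ forces $n=0$. -/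
theorem det_sub_one_ne_zero {γ : Γ} (hγ : γ ≠ 1) : (mat γ - 1).det ≠ 0 := by
  intro h
  have h1 := one_add_pow_of_sq_zero (sub_one_mul_self (det_mat γ) h) (Fintype.card Γ)
  rw [add_sub_cancel, ← mat_pow, pow_card_eq_one, mat_one, left_eq_add] at h1
  have h2 := (smul_eq_zero.mp h1).resolve_left (Nat.cast_ne_zero.mpr Fintype.card_ne_zero)
  exact hγ (mat_injective (by rw [mat_one]; exact sub_eq_zero.mp h2))

theorem eq_one_of_fixes {γ : Γ} {v : L} (hv : v ≠ 0) (h : (mat γ).mulVec v = v) : γ = 1 := by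
  by_contra hγ
  refine det_sub_one_ne_zero hγ (exists_mulVec_eq_zero_iff.mp ⟨v, hv, ?_⟩)
  rw [sub_mulVec, h, one_mulVec, sub_self]

theorem exists_mulVec_sub {z : Γ} (hz : z ≠ 1) (u : L) : ∃ v : L, (mat z).mulVec v - v = u := by
  have hu : IsUnit (mat z - 1).det := (det_sub_one_ne_zero hz).isUnit
  refine ⟨(mat z - 1)⁻¹.mulVec u, ?_⟩
  have : (mat z - 1).mulVec ((mat z - 1)⁻¹.mulVec u) = u := by
    rw [mulVec_mulVec, mul_nonsing_inv _ hu, one_mulVec]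
  rwa [sub_mulVec, one_mulVec] at this

theorem sum_mat_eq_zero (hΓ : ∃ γ : Γ, γ ≠ 1) : ∑ γ : Γ, mat γ = 0 := by
  obtain ⟨γ, hγ⟩ := hΓ
  have h1 : (mat γ - 1) * ∑ δ : Γ, mat δ = 0 := by
    rw [sub_mul, one_mul, Finset.mul_sum, sub_eq_zero]
    exact Fintype.sum_equiv (Equiv.mulLeft γ) _ _ fun δ => (mat_mul γ δ).symm
  have hu : IsUnit (mat γ - 1).det := (det_sub_one_ne_zero hγ).isUnit
  rw [← nonsing_inv_mul_cancel_left _ (∑ δ : Γ, mat δ) hu, h1, mul_zero]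

/-- In odd order squaring is a bijection, so $\sum\gamma^2=\sum\gamma=0$. As
$\operatorname{tr}\gamma^2=(\operatorname{tr}\gamma)^2-2$, this gives
$\sum(\operatorname{tr}\gamma)^2=2|\Gamma|$, whereas irreducibility would give $|\Gamma|$. -/
theorem not_irreducible_of_odd (hΓ : ∃ γ : Γ, γ ≠ 1) (hodd : Odd (Fintype.card Γ)) :
    ¬ (natRep Γ).IsIrreducible := by
  intro hirr
  let _ : Invertible (Nat.card Γ : ℂ) :=
    invertibleOfNonzero (Nat.cast_ne_zero.mpr Nat.card_pos.ne')
  have h1 := Representation.char_orthonormal (natRep Γ) (natRep Γ)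
  rw [if_pos ⟨.refl _⟩] at h1
  simp only [natRep_character, trace_mat_inv] at h1
  have hsq : ∑ γ : Γ, mat (γ ^ 2) = ∑ γ : Γ, mat γ := by
    have hco : (Nat.card Γ).Coprime 2 := by
      rw [Nat.card_eq_fintype_card]; exact hodd.coprime_two_right
    exact Fintype.sum_equiv (powCoprime hco) _ _ fun γ => rfl
  rw [sum_mat_eq_zero hΓ] at hsq
  have h2 := congrArg trace hsq
  simp only [trace_sum, pow_two, mat_mul, trace_sq_eq _ (det_mat _), trace_sub, trace_smul,
    trace_one, trace_zero, smul_eq_mul, Finset.sum_sub_distrib, Finset.sum_const] at h2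
  have hc : (Nat.card Γ : ℂ) ≠ 0 := Nat.cast_ne_zero.mpr Nat.card_pos.ne'
  rw [inv_mul_eq_iff_eq_mul₀ hc] at h1
  rw [h1] at h2
  simp at h2
  apply hc
  rw [Nat.card_eq_fintype_card]
  linear_combination -h2

/-- On a stable line $\gamma\delta$ and $\delta\gamma$ agree, and only the identity of $\Gamma$
fixes a nonzero vector. -/
theorem commute_of_not_irreducible (h : ¬ (natRep Γ).IsIrreducible) (γ δ : Γ) :
    γ * δ = δ * γ := by
  obtain ⟨U, hU1, hU2⟩ : ∃ U : Subrepresentation (natRep Γ),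
      U.toSubmodule ≠ ⊥ ∧ U.toSubmodule ≠ ⊤ := by
    by_contra hno
    push Not at hno
    refine h (@IsSimpleOrder.mk _ _ _ ⟨⊥, ⊤, fun hbt => ?_⟩ fun U => ?_)
    · have := congrArg Subrepresentation.toSubmodule hbt
      exact bot_ne_top (α := Submodule ℂ L) this
    · by_cases hU : U.toSubmodule = ⊥
      · exact Or.inl (Subrepresentation.toSubmodule_injective hU)
      · exact Or.inr (Subrepresentation.toSubmodule_injective (hno U hU))
  have hfin : Module.finrank ℂ U.toSubmodule = 1 := by
    have h1 := Submodule.finrank_lt hU2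
    have h2 : Module.finrank ℂ U.toSubmodule ≠ 0 := fun h0 => hU1 (Submodule.finrank_eq_zero.mp h0)
    simp at h1
    omega
  obtain ⟨v, hv, hspan⟩ := finrank_eq_one_iff'.mp hfin
  have hsc : ∀ γ : Γ, ∃ a : ℂ, (mat γ).mulVec v = a • (v : L) := fun γ => by
    obtain ⟨a, ha⟩ := hspan ⟨natRep Γ γ v, U.apply_mem_toSubmodule γ v.2⟩
    exact ⟨a, (congrArg Subtype.val ha).symm⟩
  have hv' : (v : L) ≠ 0 := fun h => hv (Subtype.ext h)
  obtain ⟨a, ha⟩ := hsc γ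
  obtain ⟨b, hb⟩ := hsc δ
  have hcomm : (mat (γ * δ)).mulVec v = (mat (δ * γ)).mulVec v := by
    rw [mat_mul, mat_mul, ← mulVec_mulVec, ← mulVec_mulVec, ha, hb, mulVec_smul, mulVec_smul, ha,
      hb, smul_comm]
  have : (δ * γ)⁻¹ * (γ * δ) = 1 := by
    apply eq_one_of_fixes hv'
    rw [mat_mul, ← mulVec_mulVec, hcomm, mulVec_mulVec, ← mat_mul, inv_mul_cancel, mat_one,
      one_mulVec]
  exact (inv_mul_eq_one.mp this).symm

/-- A nontrivial finite subgroup of `SL(2, ℂ)` has nontrivial center. -/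
theorem exists_central_ne_one (hΓ : Γ ≠ ⊥) : ∃ z : Γ, z ≠ 1 ∧ ∀ γ, γ * z = z * γ := by
  obtain ⟨γ₀, hγ₀⟩ : ∃ γ : Γ, γ ≠ 1 := by
    by_contra hno
    push Not at hno
    refine hΓ ((Subgroup.eq_bot_iff_forall _).mpr fun x hx => ?_)
    exact congrArg Subtype.val (hno ⟨x, hx⟩)
  rcases Nat.even_or_odd (Fintype.card Γ) with he | ho
  -- In even order an element $z$ of order $2$ satisfies $(z-1)(z+1)=0$ with $z-1$ invertible, so
  -- $z=-1$. In odd order $\Gamma$ is abelian.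
  · have : Fact (Nat.Prime 2) := ⟨Nat.prime_two⟩
    obtain ⟨z, hz⟩ := exists_prime_orderOf_dvd_card 2 he.two_dvd
    have hz1 : z ≠ 1 := by
      rintro rfl
      simp at hz
    refine ⟨z, hz1, fun γ => mat_injective ?_⟩
    have hzz : mat z * mat z = 1 := by
      rw [← mat_mul, ← pow_two, orderOf_dvd_iff_pow_eq_one.mp hz.dvd, mat_one]
    have h1 : (mat z - 1) * (mat z + 1) = 0 := by
      rw [sub_mul, mul_add, hzz, mul_one, one_mul, add_comm, sub_self]
    have h2 : mat z + 1 = 0 := by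
      rw [← nonsing_inv_mul_cancel_left _ (mat z + 1) (det_sub_one_ne_zero hz1).isUnit, h1,
        mul_zero]
    rw [mat_mul, mat_mul, eq_neg_of_add_eq_zero_left h2]
    simp
  · exact ⟨γ₀, hγ₀, fun γ =>
      commute_of_not_irreducible (not_irreducible_of_odd ⟨γ₀, hγ₀⟩ ho) γ γ₀⟩

end SympRefl

/-! ### Class sums, Schur's lemma and orthogonality -/

open scoped Classical in
theorem classSum_eq {G Y : Type*} [Group G] [Fintype G] [AddCommGroup Y] [Module ℂ Y]
    (c : ConjClasses G → ℂ) (ρ : Representation ℂ G Y) :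
    classSum c ρ = ∑ g ∈ Finset.univ.filter (fun g : G => g ≠ 1),
      c (ConjClasses.mk g) * ρ.character g := by
  have hmaps : ∀ g ∈ Finset.univ.filter (fun g : G => g ≠ 1),
      ConjClasses.mk g ∈ Finset.univ.filter (fun C : ConjClasses G => C ≠ ConjClasses.mk 1) := by
    intro g hg
    simp only [Finset.mem_filter, Finset.mem_univ, true_and] at hg ⊢
    rwa [Ne, ConjClasses.mk_eq_mk_iff_isConj, isConj_comm, isConj_one_right]
  rw [classSum, ← Finset.sum_fiberwise_of_maps_to hmaps]
  refine Finset.sum_congr rfl fun C hC => ?_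
  rw [Finset.sum_congr rfl (g := fun _ => c C * classCharacter ρ C)]
  · rw [Finset.sum_const, nsmul_eq_mul]
    have : (Nat.card C.carrier) = ((Finset.univ.filter (fun g : G => g ≠ 1)).filter
        (fun g => ConjClasses.mk g = C)).card := by
      refine Nat.subtype_card _ fun g => ?_
      simp only [Finset.mem_filter, Finset.mem_univ, true_and, ConjClasses.mem_carrier_iff_mk_eq,
        and_iff_right_iff_imp]
      rintro rfl rfl
      simp at hC
    rw [this]; ring
  · intro g hg
    rw [← (Finset.mem_filter.mp hg).2]
    rfl

section Schur

variable {G Y M : Type*} [Group G] [AddCommGroup Y] [Module ℂ Y] [FiniteDimensional ℂ Y]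
  [AddCommGroup M] [Module ℂ M]

theorem Representation.IsIrreducible.finrank_ne_zero {ρ : Representation ℂ G Y}
    (hρ : ρ.IsIrreducible) : (Module.finrank ℂ Y : ℂ) ≠ 0 := by
  have h1 : (Module.finrank ℂ Y) ≠ 0 := fun h => by
    have : Subsingleton Y := Module.finrank_zero_iff.mp h
    obtain ⟨U, V, hUV⟩ := hρ.exists_pair_ne
    exact hUV (Subrepresentation.toSubmodule_injective (Subsingleton.elim _ _))
  exact_mod_cast h1

theorem Representation.IsIrreducible.nontrivial_space {ρ : Representation ℂ G Y}
    (hρ : ρ.IsIrreducible) : Nontrivial Y := by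
  refine Module.nontrivial_of_finrank_pos (R := ℂ) (Nat.pos_of_ne_zero fun h => ?_)
  exact hρ.finrank_ne_zero (by rw [h, Nat.cast_zero])

/-- Schur's lemma. -/
theorem Representation.IsIrreducible.eq_smul_one {ρ : Representation ℂ G Y}
    (hρ : ρ.IsIrreducible) {f : Module.End ℂ Y} (hf : ∀ g, f * ρ g = ρ g * f) :
    f = (LinearMap.trace ℂ Y f / Module.finrank ℂ Y) • (1 : Module.End ℂ Y) := by
  let F : IntertwiningMap ρ ρ := ⟨f, hf⟩
  obtain ⟨a, ha⟩ := IsIrreducible.algebraMap_intertwiningMap_bijective_of_isAlgClosed.2 F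
  have h1 : f = a • (1 : Module.End ℂ Y) := by
    have := congrArg IntertwiningMap.toLinearMap ha
    ext y
    exact (LinearMap.congr_fun this y).symm
  have h2 : LinearMap.trace ℂ Y f = a * Module.finrank ℂ Y := by
    rw [h1, map_smul, LinearMap.trace_one, smul_eq_mul]
  rw [h2, mul_div_cancel_right₀ _ hρ.finrank_ne_zero, ← h1]

variable [Fintype G]

theorem Representation.IsIrreducible.sum_conj {ρ : Representation ℂ G Y}
    (hρ : ρ.IsIrreducible) (A : Module.End ℂ Y) :
    ∑ g : G, ρ g * A * ρ g⁻¹ =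
      ((Fintype.card G : ℂ) / Module.finrank ℂ Y * LinearMap.trace ℂ Y A) •
        (1 : Module.End ℂ Y) := by
  rw [hρ.eq_smul_one (f := ∑ g : G, ρ g * A * ρ g⁻¹)]
  · congr 1
    rw [map_sum]
    have : ∀ g : G, LinearMap.trace ℂ Y (ρ g * A * ρ g⁻¹) = LinearMap.trace ℂ Y A := fun g => by
      rw [LinearMap.trace_mul_comm, ← mul_assoc, ← map_mul, inv_mul_cancel, map_one, one_mul]
    simp only [this, Finset.sum_const, Finset.card_univ, nsmul_eq_mul]
    ring
  · intro h
    rw [Finset.sum_mul, Finset.mul_sum]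
    refine Fintype.sum_equiv (Equiv.mulLeft h⁻¹) _ _ fun g => ?_
    simp only [Equiv.coe_mulLeft, mul_inv_rev, inv_inv, map_mul]
    have hh : ρ h * ρ h⁻¹ = 1 := by rw [← map_mul, mul_inv_cancel, map_one]
    simp only [mul_assoc]
    rw [← mul_assoc (ρ h) (ρ h⁻¹), hh, one_mul]

/-- The orthogonality relations for matrix coefficients. -/
theorem Representation.IsIrreducible.sum_bilin {ρ : Representation ℂ G Y}
    (hρ : ρ.IsIrreducible) (B : Y →ₗ[ℂ] Y →ₗ[ℂ] M) (u v : Y) :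
    ∑ g : G, B (ρ g⁻¹ v) (ρ g u) = ((Fintype.card G : ℂ) / Module.finrank ℂ Y) • B u v := by
  let b := Module.finBasis ℂ Y
  -- The averaging formula `sum_conj` for the rank one operator $y\mapsto b_m^*(y)\,u$, whose trace
  -- is $b_m^*(u)$.
  have h1 : ∀ m, ∑ g : G, b.repr (ρ g⁻¹ v) m • ρ g u =
      ((Fintype.card G : ℂ) / Module.finrank ℂ Y * b.repr u m) • v := fun m => by
    have := LinearMap.congr_fun (hρ.sum_conj ((b.coord m).smulRight u)) v
    rw [LinearMap.sum_apply] at this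
    simpa using this
  have h2 : ∀ g : G, B (ρ g⁻¹ v) (ρ g u) = ∑ m, B (b m) (b.repr (ρ g⁻¹ v) m • ρ g u) := by
    intro g
    conv_lhs => rw [← b.sum_repr (ρ g⁻¹ v)]
    simp only [map_sum, map_smul, LinearMap.sum_apply, LinearMap.smul_apply]
  simp only [h2]
  rw [Finset.sum_comm]
  simp only [← map_sum, h1]
  conv_rhs => rw [← b.sum_repr u]
  simp only [map_sum, map_smul, LinearMap.sum_apply, LinearMap.smul_apply, Finset.smul_sum,
    smul_smul]

open scoped Classical in
theorem Representation.IsIrreducible.sum_class {ρ : Representation ℂ G Y}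
    (hρ : ρ.IsIrreducible) (c : ConjClasses G → ℂ) :
    ∑ g ∈ Finset.univ.filter (fun g : G => g ≠ 1), c (ConjClasses.mk g) • ρ g =
      (classSum c ρ / Module.finrank ℂ Y) • (1 : Module.End ℂ Y) := by
  rw [hρ.eq_smul_one (f := ∑ g ∈ Finset.univ.filter (fun g : G => g ≠ 1),
    c (ConjClasses.mk g) • ρ g)]
  · rw [classSum_eq, map_sum]
    simp only [map_smul, smul_eq_mul]
    rfl
  · intro h
    rw [Finset.sum_mul, Finset.mul_sum]
    refine Finset.sum_bij' (fun g _ => h⁻¹ * g * h) (fun g _ => h * g * h⁻¹) ?_ ?_ ?_ ?_ ?_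
    · intro g hg
      simp only [Finset.mem_filter, Finset.mem_univ, true_and] at hg ⊢
      intro h1
      apply hg
      rw [mul_assoc, inv_mul_eq_one] at h1
      exact right_eq_mul.mp h1
    · intro g hg
      simpa using hg
    · intro g _; group
    · intro g _; group
    · intro g _
      have h1 : ConjClasses.mk (h⁻¹ * g * h) = ConjClasses.mk g := by
        rw [ConjClasses.mk_eq_mk_iff_isConj, isConj_iff]
        exact ⟨h, by group⟩
      rw [h1, smul_mul_assoc, mul_smul_comm, ← map_mul, ← map_mul]
      congr 2
      group

end Schur

/-! ### Action on the tensor power -/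

section TensorPower

variable {G Y : Type*} [Group G] [AddCommGroup Y] [Module ℂ Y] {N : ℕ}

theorem tensorPower_factor (ρ : Representation ℂ G Y) (i : Fin N) (g : G) (v : Fin N → Y) :
    tensorPower ρ N (Wreath.factor i g) (PiTensorProduct.tprod ℂ v) =
      PiTensorProduct.tprod ℂ (Function.update v i (ρ g (v i))) := by
  rw [tensorPower_tprod]
  congr 1
  funext m
  by_cases h : m = i
  · subst h; simp [Wreath.factor]
  · simp [Wreath.factor, h]

theorem tensorPower_transp (ρ : Representation ℂ G Y) {i j : Fin N} (hij : i ≠ j) (g : G)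
    (v : Fin N → Y) :
    tensorPower ρ N (Wreath.transp i j * Wreath.factor i g * Wreath.factor j g⁻¹)
        (PiTensorProduct.tprod ℂ v) =
      PiTensorProduct.tprod ℂ
        (Function.update (Function.update v i (ρ g⁻¹ (v j))) j (ρ g (v i))) := by
  have h1 : tensorPower ρ N (Wreath.transp i j : Wreath G N) (PiTensorProduct.tprod ℂ
      (Function.update (Function.update v j (ρ g⁻¹ (v j))) i (ρ g (v i)))) =
      PiTensorProduct.tprod ℂ
        (Function.update (Function.update v i (ρ g⁻¹ (v j))) j (ρ g (v i))) := by
    rw [tensorPower_tprod]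
    congr 1
    funext m
    by_cases hi : m = i
    · subst hi; simp [Wreath.transp, hij, Ne.symm hij]
    · by_cases hj : m = j
      · subst hj; simp [Wreath.transp]
      · simp [Wreath.transp, hi, hj, Equiv.swap_apply_of_ne_of_ne hi hj]
  rw [map_mul, map_mul, Module.End.mul_apply, Module.End.mul_apply, tensorPower_factor,
    tensorPower_factor, Function.update_of_ne hij, h1]

/-- A pure tensor as a bilinear function of two of its factors. -/
def tprodBilin (v : Fin N → Y) {i j : Fin N} (hij : i ≠ j) :
    Y →ₗ[ℂ] Y →ₗ[ℂ] PiTensorProduct ℂ (fun _ : Fin N => Y) :=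
  LinearMap.mk₂ ℂ
    (fun y y' => PiTensorProduct.tprod ℂ (Function.update (Function.update v i y) j y'))
    (fun a b y => by simp only [Function.update_comm hij, MultilinearMap.map_update_add])
    (fun a b y => by simp only [Function.update_comm hij, MultilinearMap.map_update_smul])
    (fun a b y => by simp only [MultilinearMap.map_update_add])
    (fun a b y => by simp only [MultilinearMap.map_update_smul])

/-- The transposition exchanges the two factors and the orthogonality relation exchanges them back,
so only a scalar is left. -/
theorem sum_tensorPower_transp [FiniteDimensional ℂ Y] [Fintype G] {ρ : Representation ℂ G Y}
    (hρ : ρ.IsIrreducible) {i j : Fin N} (hij : i ≠ j) :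
    ∑ g : G, tensorPower ρ N (Wreath.transp i j * Wreath.factor i g * Wreath.factor j g⁻¹) =
      ((Fintype.card G : ℂ) / Module.finrank ℂ Y) • 1 := by
  ext v
  have h1 := hρ.sum_bilin (tprodBilin v hij) (v i) (v j)
  simp only [tprodBilin, LinearMap.mk₂_apply] at h1
  simp only [LinearMap.compMultilinearMap_apply, LinearMap.sum_apply, tensorPower_transp ρ hij, h1]
  simp

theorem sum_tensorPower_factor {ρ : Representation ℂ G Y} {s : Finset G} {a : G → ℂ} {r : ℂ}
    (h : ∑ g ∈ s, a g • ρ g = r • 1) (i : Fin N) :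
    ∑ g ∈ s, a g • tensorPower ρ N (Wreath.factor i g) = r • 1 := by
  ext v
  have h1 := congrArg
    ((PiTensorProduct.tprod ℂ : MultilinearMap ℂ (fun _ : Fin N => Y) _).toLinearMap v i)
    (LinearMap.congr_fun h (v i))
  rw [LinearMap.sum_apply, map_sum] at h1
  simp only [LinearMap.smul_apply, map_smul, MultilinearMap.toLinearMap_apply,
    Module.End.one_apply, Function.update_eq_self] at h1
  simpa [tensorPower_factor] using h1

end TensorPower

/-! ### Action on $W\otimes Y^{\otimes N}$ -/

section Action

variable {G : Type*} [Group G] {N : ℕ} {Y W : Type*} [AddCommGroup Y] [Module ℂ Y]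
  [AddCommGroup W] [Module ℂ W]

theorem trivialType_apply (ρW : Representation ℂ (Equiv.Perm (Fin N)) W)
    (ρY : Representation ℂ G Y) (g : Wreath G N) :
    trivialType ρW ρY g = TensorProduct.map (ρW g.right) (tensorPower ρY N g) := rfl

theorem trivialType_factor (ρW : Representation ℂ (Equiv.Perm (Fin N)) W)
    (ρY : Representation ℂ G Y) (i : Fin N) (g : G) :
    trivialType ρW ρY (Wreath.factor i g) =
      TensorProduct.map 1 (tensorPower ρY N (Wreath.factor i g)) := by
  rw [trivialType_apply]
  congr 1
  exact map_one ρW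

theorem trivialType_transp (ρW : Representation ℂ (Equiv.Perm (Fin N)) W)
    (ρY : Representation ℂ G Y) (i j : Fin N) (g : G) :
    trivialType ρW ρY (Wreath.transp i j * Wreath.factor i g * Wreath.factor j g⁻¹) =
      TensorProduct.map (ρW (Equiv.swap i j)) (tensorPower ρY N
        (Wreath.transp i j * Wreath.factor i g * Wreath.factor j g⁻¹)) := by
  rw [trivialType_apply]
  rfl

theorem TensorProduct.map_sum_right {ι V : Type*} [AddCommGroup V] [Module ℂ V] (s : Finset ι)
    (f : Module.End ℂ W) (h : ι → Module.End ℂ V) :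
    TensorProduct.map f (∑ x ∈ s, h x) = ∑ x ∈ s, TensorProduct.map f (h x) :=
  map_sum (TensorProduct.mapBilinear (.id ℂ) W V W V f) h s

theorem TensorProduct.map_sum_left {ι V : Type*} [AddCommGroup V] [Module ℂ V] (s : Finset ι)
    (f : ι → Module.End ℂ W) (h : Module.End ℂ V) :
    TensorProduct.map (∑ x ∈ s, f x) h = ∑ x ∈ s, TensorProduct.map (f x) h :=
  map_sum ((TensorProduct.mapBilinear (.id ℂ) W V W V).flip h) f s

theorem eq_zero_of_map_one_eq_zero {V : Type*} [AddCommGroup V] [Module ℂ V] [Nontrivial V]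
    {f : Module.End ℂ W} (h : TensorProduct.map f (1 : Module.End ℂ V) = 0) : f = 0 := by
  obtain ⟨t, ht⟩ := exists_ne (0 : V)
  obtain ⟨φ, hφ⟩ : ∃ φ : Module.Dual ℂ V, φ t ≠ 0 := by
    by_contra hno
    push Not at hno
    exact ht ((Module.forall_dual_apply_eq_zero_iff ℂ t).mp hno)
  ext w
  have h1 := LinearMap.congr_fun h (w ⊗ₜ[ℂ] t)
  rw [TensorProduct.map_tmul, Module.End.one_apply, LinearMap.zero_apply] at h1
  have h2 := congrArg ((TensorProduct.rid ℂ W).toLinearMap ∘ₗ TensorProduct.map LinearMap.id φ) h1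
  simpa [hφ] using h2

instance [Nontrivial Y] : Nontrivial (PiTensorProduct ℂ (fun _ : Fin N => Y)) := by
  obtain ⟨y, hy⟩ := exists_ne (0 : Y)
  obtain ⟨φ, hφ⟩ : ∃ φ : Module.Dual ℂ Y, φ y ≠ 0 := by
    by_contra hno
    push Not at hno
    exact hy ((Module.forall_dual_apply_eq_zero_iff ℂ y).mp hno)
  refine ⟨PiTensorProduct.tprod ℂ (fun _ => y), 0, fun h => ?_⟩
  have h1 := congrArg (PiTensorProduct.lift
    ((MultilinearMap.mkPiAlgebra ℂ (Fin N) ℂ).compLinearMap fun _ => φ)) h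
  rw [PiTensorProduct.lift.tprod, map_zero] at h1
  simp [hφ] at h1

theorem sum_trivialType_transp [FiniteDimensional ℂ Y] [Fintype G]
    (ρW : Representation ℂ (Equiv.Perm (Fin N)) W)
    {ρY : Representation ℂ G Y} (hY : ρY.IsIrreducible) {i j : Fin N} (hij : i ≠ j) :
    ∑ g : G, trivialType ρW ρY
        (Wreath.transp i j * Wreath.factor i g * Wreath.factor j g⁻¹) =
      ((Fintype.card G : ℂ) / Module.finrank ℂ Y) •
        TensorProduct.map (ρW (Equiv.swap i j)) 1 := by
  simp only [trivialType_transp]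
  rw [← TensorProduct.map_sum_right, sum_tensorPower_transp hY hij, TensorProduct.map_smul_right]

theorem sum_trivialType_factor
    (ρW : Representation ℂ (Equiv.Perm (Fin N)) W)
    {ρY : Representation ℂ G Y} {s : Finset G} {a : G → ℂ} {r : ℂ}
    (h : ∑ g ∈ s, a g • ρY g = r • 1) (i : Fin N) :
    ∑ g ∈ s, a g • trivialType ρW ρY (Wreath.factor i g) = r • 1 := by
  simp only [trivialType_factor, ← TensorProduct.map_smul_right]
  rw [← TensorProduct.map_sum_right, sum_tensorPower_factor h i, TensorProduct.map_smul_right,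
    TensorProduct.map_one]

theorem trivialType_factor_of_scalar
    (ρW : Representation ℂ (Equiv.Perm (Fin N)) W)
    {ρY : Representation ℂ G Y} {g : G} {r : ℂ} (h : ρY g = r • 1) (i : Fin N) :
    trivialType ρW ρY (Wreath.factor i g) = r • 1 := by
  have := sum_trivialType_factor ρW (ρY := ρY) (s := {g}) (a := fun _ => 1) (r := r)
    (by simpa using h) i
  simpa using this

theorem Wreath.factor_mul (i : Fin N) (g h : G) :
    (Wreath.factor i (g * h) : Wreath G N) = Wreath.factor i g * Wreath.factor i h := by
  rw [Wreath.factor, Wreath.factor, Wreath.factor, ← map_mul, Pi.mulSingle_mul]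

end Action

/-! ### Vanishing of the vectors and the resulting extension criterion -/

namespace SympRefl

variable {Γ : Subgroup (Matrix.SpecialLinearGroup (Fin 2) ℂ)} {N : ℕ}
  {M : Type*} [AddCommGroup M] [Module ℂ M]

theorem act_factor (i : Fin N) (γ : Γ) (u : L) :
    act Γ N (Wreath.factor i γ) (Pi.single i u) = Pi.single i ((mat γ).mulVec u) := by
  funext m
  have h0 : (Wreath.factor i γ : Wreath Γ N).right⁻¹ m = m := rfl
  rw [act, h0]
  by_cases h : m = i
  · subst h; simp [Wreath.factor]
  · simp [Wreath.factor, h]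

/-- The homomorphism from the free algebra in which the vectors act by zero. -/
def evalZero (ρ : Representation ℂ (Wreath Γ N) M) : Free Γ N →ₐ[ℂ] Module.End ℂ M :=
  FreeAlgebra.lift ℂ (Sum.elim (fun g => ρ g) fun _ => 0)

theorem evalZero_grp (ρ : Representation ℂ (Wreath Γ N) M) (g : Wreath Γ N) :
    evalZero ρ (grp g) = ρ g := by
  simp [evalZero, grp]

theorem evalZero_vec (ρ : Representation ℂ (Wreath Γ N) M) (v : Fin N → L) :
    evalZero ρ (vec v) = 0 := by
  simp [evalZero, vec]

variable [Fintype Γ]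

theorem omegaL_sub_left (u u' v : L) : omegaL (u - u') v = omegaL u v - omegaL u' v := by
  simp [omegaL]; ring

variable {Y W : Type*} [AddCommGroup Y] [Module ℂ Y] [AddCommGroup W] [Module ℂ W]

/-- The off-diagonal commutators vanish as soon as a nontrivial central element acts by a
scalar. -/
theorem sum_omegaL_smul_eq_zero (ρW : Representation ℂ (Equiv.Perm (Fin N)) W)
    (ρY : Representation ℂ Γ Y) {z : Γ} (hz : z ≠ 1) {r : ℂ} (hr : r ≠ 0) (hzr : ρY z = r • 1)
    (i j : Fin N) (u v : L) :
    ∑ γ : Γ, omegaL ((mat γ).mulVec u) v • trivialType ρW ρY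
      (Wreath.transp i j * Wreath.factor i γ * Wreath.factor j γ⁻¹) = 0 := by
  have hzr' : ρY z⁻¹ = r⁻¹ • 1 := by
    have h1 : ρY z⁻¹ * ρY z = 1 := by rw [← map_mul, inv_mul_cancel, map_one]
    rw [hzr, mul_smul_comm, mul_one] at h1
    rw [← h1, smul_smul, inv_mul_cancel₀ hr, one_smul]
  set T : Γ → Module.End ℂ _ := fun γ => trivialType ρW ρY
      (Wreath.transp i j * Wreath.factor i γ * Wreath.factor j γ⁻¹) with hT
  -- The extra $z_i$ and $z_j^{-1}$ act by $r$ and $r^{-1}$.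
  have hinv : ∀ γ, T (γ * z) = T γ := fun γ => by
    simp only [hT]
    rw [mul_inv_rev, Wreath.factor_mul, Wreath.factor_mul]
    simp only [map_mul]
    rw [trivialType_factor_of_scalar ρW hzr, trivialType_factor_of_scalar ρW hzr']
    simp only [mul_smul_comm, smul_mul_assoc, mul_one, one_mul, smul_smul, one_smul,
      inv_mul_cancel₀ hr]
  have hS : ∀ u, ∑ γ : Γ, omegaL ((mat γ).mulVec ((mat z).mulVec u)) v • T γ =
      ∑ γ : Γ, omegaL ((mat γ).mulVec u) v • T γ := fun u => by
    refine Fintype.sum_equiv (Equiv.mulRight z) _ _ fun γ => ?_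
    rw [Equiv.coe_mulRight, hinv, mat_mul, Matrix.mulVec_mulVec]
  -- Every $u$ is $zu'-u'$, so the sum is a difference of two sums that agree by `hS`.
  obtain ⟨u', rfl⟩ := exists_mulVec_sub hz u
  have := sub_eq_zero.mpr (hS u')
  rw [← Finset.sum_sub_distrib] at this
  rw [← this]
  refine Finset.sum_congr rfl fun γ _ => ?_
  rw [Matrix.mulVec_sub, omegaL_sub_left]
  exact sub_smul (omegaL ((mat γ).mulVec ((mat z).mulVec u')) v)
    (omegaL ((mat γ).mulVec u') v) (T γ)

/-- The smash relation for $z_i$ and $u'_i$, with the scalar $r$ cancelled, shows that $u'_i$ and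
$(zu')_i$ act equally; the differences $zu'-u'$ fill $L$. -/
theorem vec_eq_zero {k : ℂ} {c : ConjClasses Γ → ℂ} {ρW : Representation ℂ (Equiv.Perm (Fin N)) W}
    {ρY : Representation ℂ Γ Y} {z : Γ} (hz : z ≠ 1) {r : ℂ} (hr : r ≠ 0) (hzr : ρY z = r • 1)
    (Φ : Alg N k c →ₐ[ℂ] Module.End ℂ (W ⊗[ℂ] PiTensorProduct ℂ (fun _ : Fin N => Y)))
    (hΦ : ∀ g, Φ (ofGroup k c g) = trivialType ρW ρY g) (i : Fin N) (u : L) :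
    Φ (RingQuot.mkAlgHom ℂ (Rel k c) (vecAt i u)) = 0 := by
  set F : Free Γ N →ₐ[ℂ] _ := Φ.comp (RingQuot.mkAlgHom ℂ (Rel (Γ := Γ) (N := N) k c)) with hF
  have hrel : ∀ {x y}, Rel k c x y → F x = F y := fun h => by
    simp only [hF, AlgHom.comp_apply]
    rw [RingQuot.mkAlgHom_rel ℂ h]
  have hgrp : ∀ g, F (grp g) = trivialType ρW ρY g := hΦ
  change F (vecAt i u) = 0
  obtain ⟨u', rfl⟩ := exists_mulVec_sub hz u
  have h1 := hrel (Rel.smash (Wreath.factor i z) (Pi.single i u'))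
  rw [map_mul, map_mul, hgrp, trivialType_factor_of_scalar ρW hzr, act_factor, smul_mul_assoc,
    mul_smul_comm, one_mul, mul_one] at h1
  have h2 := smul_right_injective _ hr h1
  have h3 := hrel (Rel.vec_add (Pi.single i ((mat z).mulVec u' - u')) (Pi.single i u'))
  rw [← Pi.single_add, sub_add_cancel, map_add, ← h2] at h3
  exact right_eq_add.mp h3

/-- Vectors must act by zero, so `evalZero` is the only candidate, and it respects every relation
except possibly the diagonal ones. -/
theorem extends_iff {k : ℂ} {c : ConjClasses Γ → ℂ} {ρW : Representation ℂ (Equiv.Perm (Fin N)) W}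
    {ρY : Representation ℂ Γ Y} {z : Γ} (hz : z ≠ 1) {r : ℂ} (hr : r ≠ 0)
    (hzr : ρY z = r • 1) :
    Extends k c (trivialType ρW ρY) ↔
      ∀ i, evalZero (trivialType ρW ρY) (diagRHS k c i) = 0 := by
  constructor
  · rintro ⟨Φ, hΦ⟩ i
    set F : Free Γ N →ₐ[ℂ] _ := Φ.comp (RingQuot.mkAlgHom ℂ (Rel (Γ := Γ) (N := N) k c)) with hF
    have hvec : ∀ i u, F (vecAt i u) = 0 := vec_eq_zero hz hr hzr Φ hΦ
    have hgrp : ∀ g, F (grp g) = trivialType ρW ρY g := hΦ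
    have h1 : F (diagRHS k c i) = 0 := by
      have := RingQuot.mkAlgHom_rel ℂ (Rel.diag (k := k) (c := c) i)
      have h2 := congrArg Φ this
      change F _ = F _ at h2
      rw [← h2, map_sub, map_mul, map_mul, hvec, hvec, mul_zero, sub_zero]
    rw [← h1, diagRHS]
    simp only [map_add, map_one, map_smul, map_sum, evalZero_grp, hgrp]
  · intro h
    refine ⟨RingQuot.liftAlgHom ℂ ⟨evalZero (trivialType ρW ρY), ?_⟩, fun g => ?_⟩
    · intro x y hxy
      cases hxy with
      | grp_one => rw [evalZero_grp, map_one, map_one]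
      | grp_mul g g' => rw [map_mul, evalZero_grp, evalZero_grp, evalZero_grp, map_mul]
      | vec_add v w => rw [map_add, evalZero_vec, evalZero_vec, evalZero_vec, add_zero]
      | vec_smul a v => rw [map_smul, evalZero_vec, evalZero_vec, smul_zero]
      | smash g v => rw [map_mul, map_mul, evalZero_vec, evalZero_vec, mul_zero, zero_mul]
      | diag i =>
        rw [h i, map_sub, map_mul, map_mul]
        simp only [vecAt, evalZero_vec, mul_zero, sub_zero]
      | offDiag i j hij u v =>
        rw [map_sub, map_mul, map_mul, offDiagRHS]
        simp only [vecAt, evalZero_vec, mul_zero, sub_zero, map_neg, map_smul, map_sum,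
          evalZero_grp]
        rw [sum_omegaL_smul_eq_zero ρW ρY hz hr hzr i j u v, smul_zero, neg_zero]
    · rw [ofGroup, RingQuot.liftAlgHom_mkAlgHom_apply, evalZero_grp]

variable [FiniteDimensional ℂ Y]

theorem evalZero_diagRHS (k : ℂ) (c : ConjClasses Γ → ℂ)
    (ρW : Representation ℂ (Equiv.Perm (Fin N)) W) {ρY : Representation ℂ Γ Y}
    (hY : ρY.IsIrreducible) (i : Fin N) :
    evalZero (trivialType ρW ρY) (diagRHS k c i) =
      TensorProduct.map ((1 + classSum c ρY / Module.finrank ℂ Y) • 1 +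
        (k / 2 * ((Fintype.card Γ : ℂ) / Module.finrank ℂ Y)) • YoungRep.starAct ρW i) 1 := by
  classical
  rw [diagRHS]
  simp only [map_add, map_one, map_smul, map_sum, evalZero_grp]
  have h1 := sum_trivialType_factor ρW (hY.sum_class c) i
  rw [show (∑ γ ∈ Finset.univ.filter (fun γ : Γ => γ ≠ 1), c (ConjClasses.mk γ) •
    trivialType ρW ρY (Wreath.factor i γ)) = (classSum c ρY / Module.finrank ℂ Y) • 1 from by
      convert h1]
  have h2 : ∀ j ∈ Finset.univ.filter (fun j : Fin N => j ≠ i),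
      ∑ γ : Γ, trivialType ρW ρY
        (Wreath.transp i j * Wreath.factor i γ * Wreath.factor j γ⁻¹) =
      ((Fintype.card Γ : ℂ) / Module.finrank ℂ Y) •
        TensorProduct.map (ρW (Equiv.swap i j)) 1 := fun j hj =>
    sum_trivialType_transp ρW hY (Ne.symm (Finset.mem_filter.mp hj).2)
  rw [show (∑ j ∈ Finset.univ.filter (fun j : Fin N => j ≠ i), ∑ γ : Γ, trivialType ρW ρY
    (Wreath.transp i j * Wreath.factor i γ * Wreath.factor j γ⁻¹)) =
    ((Fintype.card Γ : ℂ) / Module.finrank ℂ Y) •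
      TensorProduct.map (YoungRep.starAct ρW i) 1 from by
    rw [Finset.sum_congr (by congr!) h2, ← Finset.smul_sum, ← TensorProduct.map_sum_left]
    rfl]
  rw [TensorProduct.map_add_left, TensorProduct.map_smul_left, TensorProduct.map_smul_left,
    TensorProduct.map_one, add_smul]
  rw [one_smul, smul_smul]
  abel

end SympRefl

end

/-! ### The main equivalence -/

theorem proposition4p3
    (Γ : Subgroup (Matrix.SpecialLinearGroup (Fin 2) ℂ)) [Fintype Γ] (hΓ : Γ ≠ ⊥)
    (N : ℕ) (hN : 1 ≤ N)
    (k : ℂ) (hk : k ≠ 0) (c : ConjClasses Γ → ℂ)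
    {W : Type*} [AddCommGroup W] [Module ℂ W] [FiniteDimensional ℂ W]
    (ρW : Representation ℂ (Equiv.Perm (Fin N)) W) (hW : ρW.IsIrreducible)
    {Y : Type*} [AddCommGroup Y] [Module ℂ Y] [FiniteDimensional ℂ Y]
    (ρY : Representation ℂ Γ Y) (hY : ρY.IsIrreducible) :
    SympRefl.Extends k c (trivialType ρW ρY) ↔
      ∃ a b : ℕ, YoungRep.CorrespondsTo ρW (YoungRep.rect a b) ∧
        (Module.finrank ℂ Y : ℂ) + ((b : ℂ) - (a : ℂ)) * (k / 2) * (Fintype.card Γ : ℂ)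
          + classSum c ρY = 0 := by
  have := hW.nontrivial_space
  have := hY.nontrivial_space
  obtain ⟨z, hz, hcent⟩ := SympRefl.exists_central_ne_one hΓ
  have hzr := hY.eq_smul_one (f := ρY z) fun g => by rw [← map_mul, ← map_mul, hcent g]
  set r : ℂ := LinearMap.trace ℂ Y (ρY z) / Module.finrank ℂ Y
  have hr : r ≠ 0 := by
    intro h0
    rw [h0, zero_smul] at hzr
    have h1 : ρY z⁻¹ * ρY z = 1 := by rw [← map_mul, inv_mul_cancel, map_one]
    rw [hzr, mul_zero] at h1
    exact zero_ne_one h1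
  have hd : (Module.finrank ℂ Y : ℂ) ≠ 0 := hY.finrank_ne_zero
  have hG : (Fintype.card Γ : ℂ) ≠ 0 := Nat.cast_ne_zero.mpr Fintype.card_ne_zero
  set d : ℂ := (Module.finrank ℂ Y : ℂ)
  set n : ℂ := (Fintype.card Γ : ℂ)
  set s : ℂ := classSum c ρY
  -- The diagonal condition solved for the transposition sum; dividing by its coefficient requires
  -- $k\neq0$. The factor $1/\dim Y$ cancels.
  have key : ∀ i, SympRefl.evalZero (trivialType ρW ρY) (SympRefl.diagRHS k c i) = 0 ↔
      YoungRep.starAct ρW i = (-(d + s) / (k / 2 * n)) • 1 := by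
    intro i
    rw [SympRefl.evalZero_diagRHS k c ρW hY i]
    have hA : k / 2 * (n / d) ≠ 0 := by
      refine mul_ne_zero (div_ne_zero hk two_ne_zero) (div_ne_zero hG hd)
    have hrw : (1 + s / d) • (1 : Module.End ℂ W) + (k / 2 * (n / d)) • YoungRep.starAct ρW i =
        (k / 2 * (n / d)) • (YoungRep.starAct ρW i - (-(d + s) / (k / 2 * n)) • 1) := by
      rw [smul_sub, smul_smul, sub_eq_add_neg, ← neg_smul, add_comm]
      congr 2
      field_simp
    change TensorProduct.map ((1 + s / d) • (1 : Module.End ℂ W) +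
      (k / 2 * (n / d)) • YoungRep.starAct ρW i) 1 = 0 ↔ _
    rw [hrw]
    constructor
    · intro h
      have h1 := eq_zero_of_map_one_eq_zero h
      exact sub_eq_zero.mp ((smul_eq_zero.mp h1).resolve_left hA)
    · intro h
      rw [h, sub_self, smul_zero, TensorProduct.map_zero_left]
  rw [SympRefl.extends_iff hz hr hzr, forall_congr' key, YoungRep.starAct_eq_smul_iff hN ρW hW]
  refine exists_congr fun a => exists_congr fun b => and_congr_right fun _ => ?_
  rw [div_eq_iff (mul_ne_zero (div_ne_zero hk two_ne_zero) hG)]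
  constructor
  · intro h; linear_combination -h
  · intro h; linear_combination -h
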